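/- Locally convex spaces and manifolds are Hausdorff. For a real locally convex space $E$ let $E_{\mathbb C}=E\times E$, with the product topology and $(x+iy)(u,v)=(xu-yv,\,xv+yu)$; identify $E$ with $E\times\{0\}$. A map between complex locally convex spaces, defined on an open set, is complex analytic if it is continuous and near each point $a$ of its domain equals pointwise a convergent series $\sum_{k\ge 0}p_k(x-a)$ of continuous homogeneous polynomials $p_k$ of degree $k$. A map $f\colon U\to F$ on an open set $U\subseteq E$, where $F$ is a real locally convex space, is real analytic if it extends to a complex analytic map $W\to F_{\mathbb C}$ on some open neighbourhood $W\subseteq E_{\mathbb C}$ of $U$. Real (resp. complex) analytic manifolds are defined by atlases with real (resp. complex) analytic chart changes. A complexification of a real analytic manifold $N$ modeled on $E$ is a complex analytic manifold $N^*$ modeled on $E_{\mathbb C}$ together with a topological embedding $\varphi\colon N\to N^*$ such that each point of $\varphi(N)$ lies in the domain $U^*$ of a chart $\psi\colon U^*\to U'\subseteq E_{\mathbb C}$ of $N^*$ which is adapted, that is, $\psi(\varphi(N)\cap U^*)=E\cap U'$ and $\psi\circ\varphi\colon\varphi^{-1}(U^*)\to E\cap U'$ is a chart of $N$. **Theorem.**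 Let $M$ be a real analytic manifold modeled on a real locally convex space $E$. Assume that, as topological spaces, $M$ is regular and $E_{\mathbb C}$ is normal. Then every compact subset $K\subseteq M$ has an open neighbourhood $\Omega\subseteq M$ that admits a complexification $(\Omega^*,\varphi)$ for which $\Omega^*$ is a regular Hausdorff topological space. Moreover, $\Omega^*$ can be chosen to be glued from finitely many open subsets of $E_{\mathbb C}$ along complex analytic extensions of chart changes: it has a finite atlas of adapted charts $\psi_1,\dots,\psi_n$ such that the domains of the charts $c_i=\psi_i\circ\varphi$ cover $\Omega$ and each $\psi_j\circ\psi_i^{-1}$ is a complex analytic extension of $c_j\circ c_i^{-1}$. -/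

import Mathlib

open Set Filter Topology
open scoped Manifold

universe u v

/-- The complexification `E_ℂ = E × E` of a real locally convex space `E`, with the product
topology; the pair `(u, v)` stands for `u + i v`. -/
def Cx (E : Type*) : Type _ := E × E

namespace Cx

section Algebra

variable {E : Type*}

/-- The real part `u` of `u + i v`. -/
def re (p : Cx E) : E := Prod.fst p

/-- The imaginary part `v` of `u + i v`. -/
def im (p : Cx E) : E := Prod.snd p

/-- The element `u + i v`. -/
def mk (u v : E) : Cx E := Prod.mk u v

theorem ext {p q : Cx E} (h₁ : p.re = q.re) (h₂ : p.im = q.im) : p = q := Prod.ext h₁ h₂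

instance [TopologicalSpace E] : TopologicalSpace (Cx E) :=
  inferInstanceAs (TopologicalSpace (E × E))

instance [AddCommGroup E] : AddCommGroup (Cx E) := inferInstanceAs (AddCommGroup (E × E))

/-- `(x + i y) • (u, v) = (x u - y v, x v + y u)`. -/
instance [AddCommGroup E] [Module ℝ E] : SMul ℂ (Cx E) :=
  ⟨fun z p => mk (z.re • p.re - z.im • p.im) (z.re • p.im + z.im • p.re)⟩

theorem add_re [AddCommGroup E] (p q : Cx E) : (p + q).re = p.re + q.re := rfl

theorem add_im [AddCommGroup E] (p q : Cx E) : (p + q).im = p.im + q.im := rfl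

theorem zero_re [AddCommGroup E] : (0 : Cx E).re = 0 := rfl

theorem zero_im [AddCommGroup E] : (0 : Cx E).im = 0 := rfl

theorem smul_re [AddCommGroup E] [Module ℝ E] (z : ℂ) (p : Cx E) :
    (z • p).re = z.re • p.re - z.im • p.im := rfl

theorem smul_im [AddCommGroup E] [Module ℝ E] (z : ℂ) (p : Cx E) :
    (z • p).im = z.re • p.im + z.im • p.re := rfl

instance [AddCommGroup E] [Module ℝ E] : Module ℂ (Cx E) where
  one_smul p := ext (by simp [smul_re]) (by simp [smul_im])
  mul_smul z w p := ext
    (by simp only [smul_re, smul_im, Complex.mul_re, Complex.mul_im]; module)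
    (by simp only [smul_re, smul_im, Complex.mul_re, Complex.mul_im]; module)
  smul_zero z := ext (by simp [smul_re, zero_re, zero_im]) (by simp [smul_im, zero_re, zero_im])
  smul_add z p q := ext
    (by simp only [smul_re, add_re, add_im]; module)
    (by simp only [smul_im, add_re, add_im]; module)
  add_smul z w p := ext
    (by simp only [smul_re, add_re, Complex.add_re, Complex.add_im]; module)
    (by simp only [smul_im, add_im, Complex.add_re, Complex.add_im]; module)
  zero_smul p := ext (by simp [smul_re, zero_re]) (by simp [smul_im, zero_im])

/-- The identification of `E` with the real subspace `E × {0}` of `E_ℂ`. -/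
def ofReal [AddCommGroup E] (x : E) : Cx E := mk x 0

end Algebra

end Cx

/-- Complex analyticity of `f` on an open set `U` of a complex locally convex space: `f` is
continuous and is, near each point of `U`, the pointwise limit of a series of continuous
homogeneous polynomials (the diagonals of continuous `k`-linear maps). -/
def ComplexAnalyticOn {F G : Type*} [AddCommGroup F] [Module ℂ F] [TopologicalSpace F]
    [AddCommGroup G] [Module ℂ G] [TopologicalSpace G] (f : F → G) (U : Set F) : Prop :=
  ContinuousOn f U ∧
    ∀ a ∈ U, ∃ p : ∀ k : ℕ, ContinuousMultilinearMap ℂ (fun _ : Fin k => F) G,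
      ∀ᶠ x in 𝓝 a,
        Tendsto (fun n : ℕ => ∑ k ∈ Finset.range n, p k (fun _ => x - a)) atTop (𝓝 (f x))

/-- Real analyticity of `f` on an open set `U` of a real locally convex space: `f` extends to a
complex analytic map on an open neighbourhood of `U` in the complexification. -/
def RealAnalyticOn {E F : Type*} [AddCommGroup E] [Module ℝ E] [TopologicalSpace E]
    [AddCommGroup F] [Module ℝ F] [TopologicalSpace F] (f : E → F) (U : Set E) : Prop :=
  ∃ (W : Set (Cx E)) (g : Cx E → Cx F), IsOpen W ∧ Cx.ofReal '' U ⊆ W ∧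
    ComplexAnalyticOn g W ∧ ∀ x ∈ U, g (Cx.ofReal x) = Cx.ofReal (f x)

section Real

variable (E : Type*) [AddCommGroup E] [Module ℝ E] [TopologicalSpace E]

/-- The charted space `M` is a (Hausdorff) real analytic manifold modeled on `E`. -/
structure IsRealAnalyticManifold (M : Type*) [TopologicalSpace M] [ChartedSpace E M] :
    Prop where
  t2 : T2Space M
  compatible : ∀ e ∈ atlas E M, ∀ e' ∈ atlas E M,
    RealAnalyticOn (e.symm ≫ₕ e') (e.symm ≫ₕ e').source

variable {E}

/-- `e` is a chart of the real analytic manifold `M`, i.e. belongs to its maximal atlas. -/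
def IsRealAnalyticChart {M : Type*} [TopologicalSpace M] [ChartedSpace E M]
    (e : OpenPartialHomeomorph M E) : Prop :=
  ∀ e' ∈ atlas E M, RealAnalyticOn (e.symm ≫ₕ e') (e.symm ≫ₕ e').source ∧
    RealAnalyticOn (e'.symm ≫ₕ e) (e'.symm ≫ₕ e).source

end Real

section Complex

variable (F : Type*) [AddCommGroup F] [Module ℂ F] [TopologicalSpace F]

/-- The charted space `X` is a (Hausdorff) complex analytic manifold modeled on `F`. -/
structure IsComplexAnalyticManifold (X : Type*) [TopologicalSpace X] [ChartedSpace F X] :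
    Prop where
  t2 : T2Space X
  compatible : ∀ e ∈ atlas F X, ∀ e' ∈ atlas F X,
    ComplexAnalyticOn (e.symm ≫ₕ e') (e.symm ≫ₕ e').source

variable {F}

/-- `e` is a chart of the complex analytic manifold `X`, i.e. belongs to its maximal atlas. -/
def IsComplexAnalyticChart {X : Type*} [TopologicalSpace X] [ChartedSpace F X]
    (e : OpenPartialHomeomorph X F) : Prop :=
  ∀ e' ∈ atlas F X, ComplexAnalyticOn (e.symm ≫ₕ e') (e.symm ≫ₕ e').source ∧
    ComplexAnalyticOn (e'.symm ≫ₕ e) (e'.symm ≫ₕ e).source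

end Complex

section Complexification

variable {E : Type*} [AddCommGroup E] [Module ℝ E] [TopologicalSpace E]
  {M : Type*} [TopologicalSpace M] [ChartedSpace E M]
  {X : Type*} [TopologicalSpace X] [ChartedSpace (Cx E) X]

/-- With `M` viewed as a subset of `X` through `φ`: the chart `ψ : U* → U'` of `X` satisfies
`ψ (M ∩ U*) = E ∩ U'`, and its restriction `M ∩ U* → E ∩ U'` is the chart `c` of `M`. -/
structure RestrictsToChart (φ : M → X) (ψ : OpenPartialHomeomorph X (Cx E))
    (c : OpenPartialHomeomorph M E) : Prop where
  complexChart : IsComplexAnalyticChart ψ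
  realChart : IsRealAnalyticChart c
  image_eq : ψ '' (range φ ∩ ψ.source) = range Cx.ofReal ∩ ψ.target
  source_eq : c.source = φ ⁻¹' ψ.source
  eq_on : ∀ y ∈ c.source, ψ (φ y) = Cx.ofReal (c y)

/-- `X`, with the embedding `φ : M → X`, is a complexification of the real analytic manifold
`M` modeled on `E`. -/
structure IsComplexification (φ : M → X) : Prop where
  manifold : IsComplexAnalyticManifold (Cx E) X
  isEmbedding : IsEmbedding φ
  exists_chart : ∀ x : M, ∃ (ψ : OpenPartialHomeomorph X (Cx E))
    (c : OpenPartialHomeomorph M E), φ x ∈ ψ.source ∧ RestrictsToChart φ ψ c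

/-- The complexification `X` of `M` is glued from finitely many open subsets `ψᵢ.target` of
`E_ℂ`: the `ψᵢ` form an atlas of `X`, and the gluing maps `ψⱼ ∘ ψᵢ⁻¹` are complex analytic
extensions of the changes `cⱼ ∘ cᵢ⁻¹` between charts `cᵢ` of `M` whose domains cover `M`. -/
def IsFinitelyGlued (φ : M → X) : Prop :=
  ∃ (n : ℕ) (ψ : Fin n → OpenPartialHomeomorph X (Cx E))
    (c : Fin n → OpenPartialHomeomorph M E),
    atlas (Cx E) X = range ψ ∧
    (∀ i, RestrictsToChart φ (ψ i) (c i)) ∧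
    (⋃ i, (ψ i).source) = univ ∧ (⋃ i, (c i).source) = univ ∧
    ∀ i j,
      ComplexAnalyticOn ((ψ i).symm ≫ₕ ψ j) ((ψ i).symm ≫ₕ ψ j).source ∧
      ∀ x ∈ ((c i).symm ≫ₕ c j).source,
        Cx.ofReal x ∈ ((ψ i).symm ≫ₕ ψ j).source ∧
        ((ψ i).symm ≫ₕ ψ j) (Cx.ofReal x) = Cx.ofReal (((c i).symm ≫ₕ c j) x)

end Complexification

/-!
By compactness, `K` is covered by the interiors of finitely many closed sets `B i` in charts `c i`
such that closed subsets of `B i` have closed images in `E`. Complex analytic extensions of the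
chart changes satisfy the cocycle identities near the real points of the overlaps, by an identity
theorem which restriction to complex lines and composition with continuous linear functionals reduce
to one complex variable. Normality of `E_ℂ` makes it possible to shrink the domains of the
extensions and neighbourhoods `V i` of the closed images of the `B i` such that the cocycle
identities hold on all of `V i` and the gluing maps transport closed neighbourhoods of points to
closed sets. The first property makes the quotient of the disjoint union of the `V i` by the gluing
maps well defined, the second makes it regular.
-/

/-! ### Power series along curves -/

section PowerSeries

variable {F : Type*} [AddCommGroup F] [Module ℂ F]

theorem seminorm_sum_pow_smul_le {p : Seminorm ℂ F} {a : ℕ → F} {B : ℝ} (hB : ∀ k, p (a k) ≤ B)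
    {s : ℂ} (hs : ‖s‖ ≤ 1 / 2) (n : ℕ) :
    p (∑ k ∈ Finset.range n, s ^ k • a k) ≤ 2 * B := by
  have hB0 : 0 ≤ B := (apply_nonneg p _).trans (hB 0)
  calc p (∑ k ∈ Finset.range n, s ^ k • a k)
      ≤ ∑ k ∈ Finset.range n, p (s ^ k • a k) :=
        Finset.le_sum_of_subadditive p (map_zero p).le (map_add_le_add p) _ _
    _ ≤ ∑ k ∈ Finset.range n, (1 / 2 : ℝ) ^ k * B := by
        refine Finset.sum_le_sum fun k _ => ?_
        rw [map_smul_eq_mul, norm_pow]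
        gcongr
        exact hB k
    _ = (∑ k ∈ Finset.range n, (1 / 2 : ℝ) ^ k) * B := by rw [Finset.sum_mul]
    _ ≤ 2 * B := by
        gcongr
        exact sum_geometric_two_le n

variable [TopologicalSpace F]

/-- The curve `γ` is, near `t₀`, the pointwise sum of the power series `∑ (t - t₀)ᵏ qₖ`. The
partial sums over `k < n` are required to converge, without any uniformity in `t`. -/
def HasPointwisePowerSeriesAt (γ : ℂ → F) (q : ℕ → F) (t₀ : ℂ) : Prop :=
  ∀ᶠ t in 𝓝 t₀, Tendsto (fun n => ∑ k ∈ Finset.range n, (t - t₀) ^ k • q k) atTop (𝓝 (γ t))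

namespace HasPointwisePowerSeriesAt

variable {γ : ℂ → F} {q : ℕ → F} {t₀ : ℂ}

theorem coeff_zero [T2Space F] (h : HasPointwisePowerSeriesAt γ q t₀) : q 0 = γ t₀ := by
  refine tendsto_nhds_unique (tendsto_const_nhds.congr' ?_) h.self_of_nhds
  filter_upwards [eventually_ge_atTop 1] with n hn
  rw [Finset.sum_eq_single_of_mem 0 (Finset.mem_range.2 hn) fun k _ hk => by simp [hk], pow_zero,
    one_smul]

theorem clm_comp {G : Type*} [AddCommGroup G] [Module ℂ G] [TopologicalSpace G]
    (h : HasPointwisePowerSeriesAt γ q t₀) (l : F →L[ℂ] G) :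
    HasPointwisePowerSeriesAt (fun t => l (γ t)) (fun k => l (q k)) t₀ :=
  h.mono fun t ht => by simpa [Function.comp_def] using (l.continuous.tendsto _).comp ht

end HasPointwisePowerSeriesAt

variable [IsTopologicalAddGroup F]

theorem exists_seminorm_le_of_tendsto_sum {p : Seminorm ℂ F} (hp : Continuous p) {a : ℕ → F}
    {y : F} (hy : Tendsto (fun n => ∑ k ∈ Finset.range n, a k) atTop (𝓝 y)) :
    ∃ B, ∀ k, p (a k) ≤ B := by
  have ha : Tendsto a atTop (𝓝 0) := by
    simpa [Function.comp_def, Finset.sum_range_succ] using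
      (hy.comp (tendsto_add_atTop_nat 1)).sub hy
  obtain ⟨B, hB⟩ := ((hp.tendsto 0).comp ha).bddAbove_range
  exact ⟨B, fun k => hB ⟨k, rfl⟩⟩

theorem seminorm_sub_linear_le_of_tendsto {p : Seminorm ℂ F} (hp : Continuous p) {a : ℕ → F}
    {B : ℝ} (hB : ∀ k, p (a k) ≤ B) {s : ℂ} (hs : ‖s‖ ≤ 1 / 2) {y : F}
    (hy : Tendsto (fun n => ∑ k ∈ Finset.range n, s ^ k • a k) atTop (𝓝 y)) :
    p (y - a 0 - s • a 1) ≤ 2 * B * ‖s‖ ^ 2 := by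
  have hremainder (n : ℕ) : (∑ k ∈ Finset.range (n + 2), s ^ k • a k) - a 0 - s • a 1 =
      s ^ 2 • ∑ k ∈ Finset.range n, s ^ k • a (k + 2) := by
    rw [Finset.sum_range_succ', Finset.sum_range_succ', Finset.smul_sum]
    simp only [zero_add, pow_one, pow_zero, one_smul, smul_smul, ← pow_add, add_comm, add_left_comm]
    abel
  have hlim : Tendsto (fun n => p ((∑ k ∈ Finset.range (n + 2), s ^ k • a k) - a 0 - s • a 1))
      atTop (𝓝 (p (y - a 0 - s • a 1))) :=
    (hp.tendsto _).comp (((hy.comp (tendsto_add_atTop_nat 2)).sub_const _).sub_const _)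
  refine le_of_tendsto' hlim fun n => ?_
  rw [hremainder, map_smul_eq_mul, norm_pow, mul_comm]
  gcongr
  exact seminorm_sum_pow_smul_le (fun k => hB (k + 2)) hs n

namespace HasPointwisePowerSeriesAt

variable {γ : ℂ → F} {q : ℕ → F} {t₀ : ℂ}

theorem isBigO_seminorm_sub_linear (h : HasPointwisePowerSeriesAt γ q t₀) {p : Seminorm ℂ F}
    (hp : Continuous p) :
    (fun t => p (γ t - q 0 - (t - t₀) • q 1)) =O[𝓝 t₀] fun t => (t - t₀) ^ 2 := by
  obtain ⟨ε, hε, hball⟩ := Metric.eventually_nhds_iff.1 h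
  have hr : 0 < ε / 2 := by positivity
  have hnorm : ‖((ε / 2 : ℝ) : ℂ)‖ = ε / 2 := by rw [Complex.norm_real, Real.norm_of_nonneg hr.le]
  set r : ℂ := ((ε / 2 : ℝ) : ℂ)
  have hr0 : r ≠ 0 := norm_pos_iff.1 (hnorm ▸ hr)
  obtain ⟨B, hB⟩ := exists_seminorm_le_of_tendsto_sum hp
    (hball (y := t₀ + r) (by rw [dist_self_add_left, hnorm]; linarith))
  simp only [add_sub_cancel_left] at hB
  refine Asymptotics.IsBigO.of_bound (2 * B / (ε / 2) ^ 2) ?_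
  filter_upwards [h, Metric.ball_mem_nhds t₀ (show 0 < ε / 4 by positivity)] with t ht htε
  rw [mem_ball_iff_norm] at htε
  have hs : ‖(t - t₀) / r‖ = ‖t - t₀‖ / (ε / 2) := by rw [norm_div, hnorm]
  have hrescale (k : ℕ) : ((t - t₀) / r) ^ k • r ^ k • q k = (t - t₀) ^ k • q k := by
    rw [smul_smul, div_pow, div_mul_cancel₀ _ (pow_ne_zero _ hr0)]
  have hle := seminorm_sub_linear_le_of_tendsto hp hB (s := (t - t₀) / r) (y := γ t)
    (by rw [hs, div_le_iff₀ hr]; linarith) (by simpa only [hrescale] using ht)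
  rw [Real.norm_of_nonneg (apply_nonneg p _), norm_pow]
  have hlinear : ((t - t₀) / r) • r ^ 1 • q 1 = (t - t₀) • q 1 := by
    simpa only [pow_one] using hrescale 1
  rw [hs, pow_zero, one_smul, hlinear] at hle
  exact hle.trans_eq (by ring)

theorem isBigO_seminorm_sub [T2Space F] (h : HasPointwisePowerSeriesAt γ q t₀) {p : Seminorm ℂ F}
    (hp : Continuous p) : (fun t => p (γ t - γ t₀)) =O[𝓝 t₀] fun t => t - t₀ := by
  have hsq : (fun t => (t - t₀) ^ 2) =O[𝓝 t₀] fun t => t - t₀ :=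
    ((Asymptotics.isLittleO_pow_id one_lt_two).comp_tendsto
      (tendsto_sub_nhds_zero_iff.2 tendsto_id)).isBigO
  have hlin : (fun t => p ((t - t₀) • q 1)) =O[𝓝 t₀] fun t => t - t₀ := by
    refine .of_bound (p (q 1)) (.of_forall fun t => ?_)
    rw [Real.norm_of_nonneg (apply_nonneg p _), map_smul_eq_mul, mul_comm]
  refine .trans (.of_bound 1 (.of_forall fun t => ?_))
    (((h.isBigO_seminorm_sub_linear hp).trans hsq).add hlin)
  rw [Real.norm_of_nonneg (apply_nonneg p _), one_mul, h.coeff_zero]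
  refine le_trans ?_ (le_abs_self _)
  simpa using map_add_le_add p (γ t - γ t₀ - (t - t₀) • q 1) ((t - t₀) • q 1)

theorem hasDerivAt {φ : ℂ → ℂ} {a : ℕ → ℂ} (h : HasPointwisePowerSeriesAt φ a t₀) :
    HasDerivAt φ (a 1) t₀ := by
  have hrem := h.isBigO_seminorm_sub_linear (p := normSeminorm ℂ ℂ) continuous_norm
  rw [h.coeff_zero] at hrem
  refine hasDerivAt_iff_isLittleO.2 (hrem.of_norm_left.trans_isLittleO ?_)
  exact (Asymptotics.isLittleO_pow_id one_lt_two).comp_tendsto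
    (tendsto_sub_nhds_zero_iff.2 tendsto_id)

end HasPointwisePowerSeriesAt

end PowerSeries

/-! ### Analytic maps along complex lines -/

section SecondOrder

/-- Two applications of the Schwarz lemma, to `f` and to its difference quotient. -/
theorem norm_sub_linear_le_of_mapsTo_ball {E : Type*} [NormedAddCommGroup E] [NormedSpace ℂ E]
    [CompleteSpace E] {f : ℂ → E} {c z : ℂ} {R M : ℝ}
    (hd : DifferentiableOn ℂ f (Metric.ball c R))
    (hM : MapsTo f (Metric.ball c R) (Metric.closedBall (f c) M)) (hz : z ∈ Metric.ball c R) :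
    ‖f z - f c - (z - c) • deriv f c‖ ≤ 2 * M * (‖z - c‖ / R) ^ 2 := by
  have hR : 0 < R := Metric.nonempty_ball.1 ⟨z, hz⟩
  have hdslope : DifferentiableOn ℂ (dslope f c) (Metric.ball c R) :=
    (Complex.differentiableOn_dslope (Metric.ball_mem_nhds c hR)).2 hd
  have hbound : ∀ w ∈ Metric.ball c R, ‖dslope f c w‖ ≤ M / R := fun w hw =>
    Complex.norm_dslope_le_div_of_mapsTo_ball hd hM hw
  have hmaps : MapsTo (dslope f c) (Metric.ball c R)
      (Metric.closedBall (dslope f c c) (2 * (M / R))) := fun w hw => by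
    rw [mem_closedBall_iff_norm, two_mul]
    exact norm_sub_le_of_le (hbound w hw) (hbound c (Metric.mem_ball_self hR))
  have hdist := Complex.dist_le_div_mul_dist_of_mapsTo_ball hdslope hmaps hz
  rw [dist_eq_norm, dist_eq_norm, dslope_same] at hdist
  calc ‖f z - f c - (z - c) • deriv f c‖ = ‖z - c‖ * ‖dslope f c z - deriv f c‖ := by
        rw [← sub_smul_dslope, ← smul_sub, norm_smul]
    _ ≤ ‖z - c‖ * (2 * (M / R) / R * ‖z - c‖) := by gcongr
    _ = 2 * M * (‖z - c‖ / R) ^ 2 := by ring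

variable {F : Type*} [AddCommGroup F] [Module ℂ F]

/-- The bound on `g` in the `p`-unit ball is used on the disc of radius `1 / p v` in the line
spanned by `v`; this disc contains `1`. -/
theorem norm_sub_lineDeriv_le {E : Type*} [NormedAddCommGroup E] [NormedSpace ℂ E]
    [CompleteSpace E] {g : F → E} {b : F} {p : Seminorm ℂ F} {M : ℝ}
    (hM : ∀ v, p v < 1 → ‖g (b + v) - g b‖ ≤ M) {v : F} (hv : p v < 1)
    (hd : ∀ t : ℂ, p (t • v) < 1 → DifferentiableAt ℂ (fun t : ℂ => g (b + t • v)) t) :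
    ‖g (b + v) - g b - lineDeriv ℂ g b v‖ ≤ 2 * M * p v ^ 2 := by
  have hs : ∀ᶠ s in 𝓝[>] p v, ‖g (b + v) - g b - lineDeriv ℂ g b v‖ ≤ 2 * M * s ^ 2 := by
    filter_upwards [Ioo_mem_nhdsGT hv] with s hs
    have hs0 : 0 < s := (apply_nonneg p v).trans_lt hs.1
    have hdisc : ∀ t ∈ Metric.ball (0 : ℂ) s⁻¹, p (t • v) < 1 := fun t ht => by
      rw [mem_ball_zero_iff] at ht
      calc p (t • v) = ‖t‖ * p v := map_smul_eq_mul p t v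
        _ ≤ ‖t‖ * s := by gcongr; exact hs.1.le
        _ < 1 := by rwa [← lt_inv_mul_iff₀' hs0, mul_one]
    have := norm_sub_linear_le_of_mapsTo_ball (f := fun t : ℂ => g (b + t • v)) (c := 0) (z := 1)
      (R := s⁻¹) (M := M) (fun t ht => (hd t (hdisc t ht)).differentiableWithinAt)
      (fun t ht => by simpa [dist_eq_norm] using hM _ (hdisc t ht))
      (by simpa using (one_lt_inv₀ hs0).2 hs.2)
    simpa [lineDeriv] using this
  exact ge_of_tendsto ((by fun_prop : Continuous fun s : ℝ => 2 * M * s ^ 2).continuousWithinAt) hs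

variable [TopologicalSpace F] [IsTopologicalAddGroup F]

theorem exists_continuous_seminorm_ball_subset [PolynormableSpace ℂ F] {V : Set F}
    (hV : V ∈ 𝓝 (0 : F)) : ∃ p : Seminorm ℂ F, Continuous p ∧ {v | p v < 1} ⊆ V := by
  have hw := PolynormableSpace.withSeminorms (𝕜 := ℂ) (E := F)
  obtain ⟨s, r, hr, hs⟩ := (hw.mem_nhds_iff 0 V).1 hV
  let q : Seminorm ℂ F := s.sup fun p : {p : Seminorm ℂ F // Continuous p} => p.1
  have hq : Continuous q := Seminorm.continuous_finsetSup fun i _ => i.2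
  let c : NNReal := ⟨r⁻¹, by positivity⟩
  refine ⟨c • q, hq.const_smul c, fun v hv => hs ?_⟩
  have hv' : r⁻¹ * q v < 1 := hv
  rwa [Seminorm.mem_ball_zero, ← mul_one r, ← inv_mul_lt_iff₀ hr]

end SecondOrder

section HolomorphicAlongLines

variable {F G : Type*} [AddCommGroup F] [Module ℂ F] [AddCommGroup G] [Module ℂ G]
  [TopologicalSpace G]

/-- `f` is weakly holomorphic along every complex affine line, at the points of `W`. This is much
weaker than complex analyticity, is stable under composition of analytic maps, and suffices for
the identity theorem. -/
def HolomorphicAlongLines (f : F → G) (W : Set F) : Prop :=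
  ∀ (l : G →L[ℂ] ℂ) (a b : F) (t : ℂ), a + t • b ∈ W →
    DifferentiableAt ℂ (fun t => l (f (a + t • b))) t

theorem HolomorphicAlongLines.mono {f : F → G} {V W : Set F} (hf : HolomorphicAlongLines f W)
    (h : V ⊆ W) : HolomorphicAlongLines f V :=
  fun l a b t ht => hf l a b t (h ht)

theorem holomorphicAlongLines_id [TopologicalSpace F] (W : Set F) :
    HolomorphicAlongLines (fun x : F => x) W := by
  intro l a b t _
  simp only [map_add, map_smul]
  fun_prop

variable [TopologicalSpace F] [IsTopologicalAddGroup F]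

theorem HolomorphicAlongLines.exists_isBigO_sub_lineDeriv [PolynormableSpace ℂ F] {g : F → ℂ}
    {W : Set F} (hg : HolomorphicAlongLines g W) {b : F} (hW : W ∈ 𝓝 b) (hgb : ContinuousAt g b) :
    ∃ p : Seminorm ℂ F, Continuous p ∧
      (fun v => g (b + v) - g b - lineDeriv ℂ g b v) =O[𝓝 0] fun v => p v ^ 2 := by
  have hb : Tendsto (b + ·) (𝓝 0) (𝓝 b) := by simpa using (continuous_const_add b).tendsto 0
  have hbd : ∀ᶠ x in 𝓝 b, ‖g x - g b‖ ≤ 1 := by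
    filter_upwards [hgb (Metric.closedBall_mem_nhds _ one_pos)] with x hx
    exact mem_closedBall_iff_norm.1 hx
  obtain ⟨p, hp, hpW⟩ := exists_continuous_seminorm_ball_subset (hb.eventually (hbd.and hW))
  refine ⟨p, hp, .of_bound (2 * 1) ?_⟩
  filter_upwards [(hp.tendsto' 0 0 (map_zero p)).eventually_lt_const one_pos] with v hv
  rw [norm_pow, Real.norm_of_nonneg (apply_nonneg p v)]
  exact norm_sub_lineDeriv_le (fun w hw => (hpW hw).1) hv
    fun t ht => hg (.id ℂ ℂ) b v t (hpW ht).2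

theorem HasPointwisePowerSeriesAt.hasDerivAt_comp [T2Space F] [PolynormableSpace ℂ F] {γ : ℂ → F}
    {q : ℕ → F} {t₀ : ℂ} (h : HasPointwisePowerSeriesAt γ q t₀) (hγ : ContinuousAt γ t₀)
    {g : F → ℂ} {W : Set F} (hg : HolomorphicAlongLines g W) (hW : W ∈ 𝓝 (γ t₀))
    (hgc : ContinuousAt g (γ t₀)) {L : F →L[ℂ] ℂ} (hL : ∀ v, lineDeriv ℂ g (γ t₀) v = L v) :
    HasDerivAt (fun t => g (γ t)) (L (q 1)) t₀ := by
  obtain ⟨p, hp, hgp⟩ := hg.exists_isBigO_sub_lineDeriv hW hgc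
  have hγ0 : Tendsto (fun t => γ t - γ t₀) (𝓝 t₀) (𝓝 0) := tendsto_sub_nhds_zero_iff.2 hγ
  have hquad : (fun t => g (γ t) - g (γ t₀) - L (γ t - γ t₀)) =O[𝓝 t₀] fun t => (t - t₀) ^ 2 := by
    have := (hgp.comp_tendsto hγ0).trans ((h.isBigO_seminorm_sub hp).pow 2)
    simpa only [Function.comp_def, add_sub_cancel, hL] using this
  have hrem : HasDerivAt (fun t => g (γ t) - g (γ t₀) - L (γ t - γ t₀)) 0 t₀ := by
    refine hasDerivAt_iff_isLittleO.2 ?_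
    simpa [Function.comp_def] using hquad.trans_isLittleO
      ((Asymptotics.isLittleO_pow_id one_lt_two).comp_tendsto
        (tendsto_sub_nhds_zero_iff.2 tendsto_id))
  have hlin : HasDerivAt (fun t => L (γ t)) (L (q 1)) t₀ := (h.clm_comp L).hasDerivAt
  simpa using ((hrem.add hlin).add_const (g (γ t₀) - L (γ t₀))).congr_of_eventuallyEq
    (.of_forall fun t => by simp only [Pi.add_apply, map_sub]; ring)

end HolomorphicAlongLines

section Expansion

variable {F G : Type*} [AddCommGroup F] [Module ℂ F] [TopologicalSpace F] [AddCommGroup G]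
  [Module ℂ G] [TopologicalSpace G]

/-- Near `a`, the map `f` is the pointwise sum of the homogeneous polynomials `x ↦ pₖ (x - a)`,
encoded as diagonals of continuous `k`-linear maps. -/
def HasHomogeneousExpansionAt (f : F → G)
    (p : ∀ k : ℕ, ContinuousMultilinearMap ℂ (fun _ : Fin k => F) G) (a : F) : Prop :=
  ∀ᶠ x in 𝓝 a, Tendsto (fun n : ℕ => ∑ k ∈ Finset.range n, p k (fun _ => x - a)) atTop (𝓝 (f x))

theorem HasHomogeneousExpansionAt.clm_comp {H : Type*} [AddCommGroup H] [Module ℂ H]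
    [TopologicalSpace H] {f : F → G}
    {p : ∀ k : ℕ, ContinuousMultilinearMap ℂ (fun _ : Fin k => F) G} {a : F}
    (h : HasHomogeneousExpansionAt f p a) (l : G →L[ℂ] H) :
    HasHomogeneousExpansionAt (fun x => l (f x))
      (fun k => l.compContinuousMultilinearMap (p k)) a :=
  h.mono fun x hx => by simpa [Function.comp_def] using (l.continuous.tendsto _).comp hx

theorem HasHomogeneousExpansionAt.hasPointwisePowerSeriesAt [IsTopologicalAddGroup F]
    [ContinuousSMul ℂ F] {f : F → G}
    {p : ∀ k : ℕ, ContinuousMultilinearMap ℂ (fun _ : Fin k => F) G} {a b : F} {t₀ : ℂ}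
    (h : HasHomogeneousExpansionAt f p (a + t₀ • b)) :
    HasPointwisePowerSeriesAt (fun t => f (a + t • b)) (fun k => p k fun _ => b) t₀ := by
  have hline : Continuous fun t : ℂ => a + t • b := by fun_prop
  filter_upwards [hline.continuousAt.eventually h] with t ht
  refine ht.congr fun n => Finset.sum_congr rfl fun k _ => ?_
  have hsub : a + t • b - (a + t₀ • b) = (t - t₀) • b := by rw [sub_smul]; abel
  simpa [hsub] using (p k).map_smul_univ (fun _ => t - t₀) (fun _ => b)

theorem ComplexAnalyticOn.mono_congr {f f' : F → G} {U V : Set F} (hf : ComplexAnalyticOn f U)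
    (hV : IsOpen V) (hVU : V ⊆ U) (h : ∀ x ∈ V, f' x = f x) : ComplexAnalyticOn f' V := by
  refine ⟨(hf.1.mono hVU).congr h, fun a ha => ?_⟩
  obtain ⟨p, hp⟩ := hf.2 a (hVU ha)
  refine ⟨p, ?_⟩
  filter_upwards [hp, hV.mem_nhds ha] with x hx hxV
  rwa [h x hxV]

variable [IsTopologicalAddGroup F] [ContinuousSMul ℂ F]

theorem ComplexAnalyticOn.holomorphicAlongLines {f : F → G} {U : Set F}
    (hf : ComplexAnalyticOn f U) : HolomorphicAlongLines f U := fun l a b _ ht =>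
  let ⟨_, hp⟩ := hf.2 (a + _ • b) ht
  (HasHomogeneousExpansionAt.clm_comp hp l).hasPointwisePowerSeriesAt.hasDerivAt.differentiableAt

theorem ComplexAnalyticOn.exists_lineDeriv_eq {f : F → G} {U : Set F} (hf : ComplexAnalyticOn f U)
    {a : F} (ha : a ∈ U) (l : G →L[ℂ] ℂ) :
    ∃ L : F →L[ℂ] ℂ, ∀ v, lineDeriv ℂ (fun x => l (f x)) a v = L v := by
  obtain ⟨p, hp⟩ := hf.2 a ha
  refine ⟨(ContinuousMultilinearMap.ofSubsingleton ℂ F ℂ 0).symm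
    (l.compContinuousMultilinearMap (p 1)), fun v => ?_⟩
  have hp' : HasHomogeneousExpansionAt f p (a + (0 : ℂ) • v) := by
    rwa [zero_smul, add_zero]
  exact (hp'.clm_comp l).hasPointwisePowerSeriesAt.hasDerivAt.deriv

theorem ComplexAnalyticOn.holomorphicAlongLines_comp [IsTopologicalAddGroup G]
    [ContinuousSMul ℂ G] [PolynormableSpace ℂ G] [T2Space G] {H : Type*} [AddCommGroup H]
    [Module ℂ H] [TopologicalSpace H] {f : F → G} {g : G → H} {U : Set F} {V : Set G}
    (hU : IsOpen U) (hV : IsOpen V) (hf : ComplexAnalyticOn f U) (hg : ComplexAnalyticOn g V) :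
    HolomorphicAlongLines (fun x => g (f x)) (U ∩ f ⁻¹' V) := by
  rintro l a b t₀ ⟨ht₀, ht₀'⟩
  obtain ⟨p, hp⟩ := hf.2 _ ht₀
  obtain ⟨L, hL⟩ := hg.exists_lineDeriv_eq ht₀' l
  have hline : Continuous fun t : ℂ => a + t • b := by fun_prop
  have hγ : ContinuousAt (fun t : ℂ => f (a + t • b)) t₀ :=
    ContinuousAt.comp (hf.1.continuousAt (hU.mem_nhds ht₀)) hline.continuousAt
  have hgl : HolomorphicAlongLines (fun x => l (g x)) V := fun l' =>
    hg.holomorphicAlongLines (l'.comp l)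
  exact ((HasHomogeneousExpansionAt.hasPointwisePowerSeriesAt hp).hasDerivAt_comp hγ hgl
    (hV.mem_nhds ht₀') (l.continuous.continuousAt.comp (hg.1.continuousAt (hV.mem_nhds ht₀')))
    hL).differentiableAt

end Expansion

/-! ### The complexification of a locally convex space -/

namespace Cx

variable {E : Type*}

theorem continuous_re [TopologicalSpace E] : Continuous (re : Cx E → E) := continuous_fst

theorem continuous_im [TopologicalSpace E] : Continuous (im : Cx E → E) := continuous_snd

theorem continuous_mk [TopologicalSpace E] {A : Type*} [TopologicalSpace A] {f g : A → E}
    (hf : Continuous f) (hg : Continuous g) : Continuous fun a => mk (f a) (g a) :=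
  Continuous.prodMk hf hg

instance [TopologicalSpace E] [T2Space E] : T2Space (Cx E) := inferInstanceAs (T2Space (E × E))

variable [AddCommGroup E]

theorem re_ofReal (x : E) : (ofReal x).re = x := rfl

theorem im_ofReal (x : E) : (ofReal x).im = 0 := rfl

theorem ofReal_zero : ofReal (0 : E) = 0 := rfl

theorem ofReal_injective : Function.Injective (ofReal : E → Cx E) :=
  Function.LeftInverse.injective re_ofReal

theorem ofReal_re_add_smul_ofReal_im [Module ℝ E] (z : Cx E) :
    ofReal z.re + Complex.I • ofReal z.im = z :=
  Cx.ext (by simp [add_re, smul_re, re_ofReal, im_ofReal])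
    (by simp [add_im, smul_im, re_ofReal, im_ofReal])

theorem ofReal_add_smul [Module ℝ E] (x y : E) (t : ℝ) :
    ofReal (x + t • y) = ofReal x + (t : ℂ) • ofReal y :=
  Cx.ext (by rw [add_re, smul_re]; simp [re_ofReal, im_ofReal])
    (by rw [add_im, smul_im]; simp [re_ofReal, im_ofReal])

variable [TopologicalSpace E]

theorem continuous_ofReal : Continuous (ofReal : E → Cx E) :=
  continuous_mk continuous_id continuous_const

theorem isClosedEmbedding_ofReal [T2Space E] : IsClosedEmbedding (ofReal : E → Cx E) :=
  Function.LeftInverse.isClosedEmbedding re_ofReal continuous_re continuous_ofReal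

instance [IsTopologicalAddGroup E] : IsTopologicalAddGroup (Cx E) :=
  inferInstanceAs (IsTopologicalAddGroup (E × E))

variable [Module ℝ E]

instance [IsTopologicalAddGroup E] [ContinuousSMul ℝ E] : ContinuousSMul ℂ (Cx E) where
  continuous_smul := by
    have hre := (continuous_re (E := E)).comp (continuous_snd (X := ℂ))
    have him := (continuous_im (E := E)).comp (continuous_snd (X := ℂ))
    have hcre := Complex.continuous_re.comp (continuous_fst (Y := Cx E))
    have hcim := Complex.continuous_im.comp (continuous_fst (Y := Cx E))
    exact continuous_mk ((hcre.smul hre).sub (hcim.smul him))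
      ((hcre.smul him).add (hcim.smul hre))

open scoped ComplexOrder in
instance [IsTopologicalAddGroup E] [LocallyConvexSpace ℝ E] : LocallyConvexSpace ℂ (Cx E) := by
  have hbasis := (LocallyConvexSpace.convex_basis_zero ℝ E).prod_nhds
    (LocallyConvexSpace.convex_basis_zero ℝ E)
  refine LocallyConvexSpace.ofBasisZero ℂ (Cx E) _ _ hbasis ?_
  rintro ⟨s, t⟩ ⟨⟨-, hs⟩, -, ht⟩ x hx y hy a b ha hb hab
  obtain ⟨ha, ha'⟩ := Complex.nonneg_iff.1 ha
  obtain ⟨hb, hb'⟩ := Complex.nonneg_iff.1 hb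
  have hab' : a.re + b.re = 1 := by simpa using congrArg Complex.re hab
  constructor
  · change (a • x + b • y).re ∈ s
    have hre : (a • x + b • y).re = a.re • x.re + b.re • y.re := by
      simp [add_re, smul_re, ← ha', ← hb']
    rw [hre]
    exact hs hx.1 hy.1 ha hb hab'
  · change (a • x + b • y).im ∈ t
    have him : (a • x + b • y).im = a.re • x.im + b.re • y.im := by
      simp [add_im, smul_im, ← ha', ← hb']
    rw [him]
    exact ht hx.2 hy.2 ha hb hab'

instance [IsTopologicalAddGroup E] [ContinuousSMul ℝ E] [LocallyConvexSpace ℝ E] :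
    PolynormableSpace ℂ (Cx E) := by
  have : ContinuousSMul ℝ (Cx E) := IsScalarTower.continuousSMul (M := ℝ) ℂ
  infer_instance

/-- The complex linear extension of a real continuous linear functional. -/
noncomputable def extendDual (l : E →L[ℝ] ℝ) : Cx E →L[ℂ] ℂ where
  toFun z := ⟨l z.re, l z.im⟩
  map_add' z w := Complex.ext (by simp [add_re]) (by simp [add_im])
  map_smul' c z := Complex.ext (by simp [smul_re]) (by simp [smul_im])
  cont := by
    have : Continuous fun z : Cx E => Complex.equivRealProdCLM.symm (l z.re, l z.im) :=
      Complex.equivRealProdCLM.symm.continuous.comp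
        ((l.continuous.comp continuous_re).prodMk (l.continuous.comp continuous_im))
    exact this.congr fun z => Complex.ext (by simp) (by simp)

theorem eq_of_forall_dual_eq [IsTopologicalAddGroup E] [ContinuousSMul ℝ E]
    [LocallyConvexSpace ℝ E] [T2Space E] {z w : Cx E} (h : ∀ l : Cx E →L[ℂ] ℂ, l z = l w) :
    z = w :=
  Cx.ext
    ((SeparatingDual.eq_iff_forall_dual_eq (R := ℝ)).2 fun l =>
      congrArg Complex.re (h (extendDual l)))
    ((SeparatingDual.eq_iff_forall_dual_eq (R := ℝ)).2 fun l =>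
      congrArg Complex.im (h (extendDual l)))

theorem eventually_forall_line_mem [IsTopologicalAddGroup E] [ContinuousSMul ℝ E] {W : Set (Cx E)}
    (hW : IsOpen W) {x : E} (hx : ofReal x ∈ W) (r : ℝ) :
    ∀ᶠ z in 𝓝 (ofReal x), ∀ t ∈ Metric.closedBall (0 : ℂ) r,
      ofReal z.re + t • ofReal z.im ∈ W := by
  refine (isCompact_closedBall (0 : ℂ) r).eventually_forall_of_forall_eventually fun t _ => ?_
  have hc : Continuous fun y : Cx E × ℂ => ofReal y.1.re + y.2 • ofReal y.1.im :=
    (continuous_ofReal.comp (continuous_re.comp continuous_fst)).add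
      (continuous_snd.smul (continuous_ofReal.comp (continuous_im.comp continuous_fst)))
  refine hc.continuousAt.eventually (hW.mem_nhds ?_)
  simp only
  rwa [re_ofReal, im_ofReal, ofReal_zero, smul_zero, add_zero]

end Cx

/-! ### The identity theorem -/

section Identity

theorem eqOn_ball_of_forall_real_eq {f g : ℂ → ℂ} {r : ℝ} (hr : 0 < r)
    (hf : DifferentiableOn ℂ f (Metric.ball 0 r)) (hg : DifferentiableOn ℂ g (Metric.ball 0 r))
    (h : ∀ t : ℝ, |t| < r → f t = g t) : EqOn f g (Metric.ball 0 r) := by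
  have hofReal : Tendsto ((↑) : ℝ → ℂ) (𝓝[≠] 0) (𝓝[≠] 0) := by
    simpa using Complex.continuous_ofReal.continuousWithinAt.tendsto_nhdsWithin
      (s := {(0 : ℝ)}ᶜ) (x := 0) (t := {(0 : ℂ)}ᶜ) fun t ht => Complex.ofReal_ne_zero.2 ht
  have hreal : ∀ᶠ t : ℝ in 𝓝[≠] 0, f t = g t := by
    filter_upwards [nhdsWithin_le_nhds (Metric.ball_mem_nhds (0 : ℝ) hr)] with t ht
    exact h t (by simpa using ht)
  exact (hf.analyticOnNhd Metric.isOpen_ball).eqOn_of_preconnected_of_frequently_eq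
    (hg.analyticOnNhd Metric.isOpen_ball) (convex_ball 0 r).isPreconnected
    (Metric.mem_ball_self hr) (hofReal.frequently hreal.frequently)

variable {E : Type*} [AddCommGroup E] [Module ℝ E] [TopologicalSpace E]
  [IsTopologicalAddGroup E] [ContinuousSMul ℝ E] [LocallyConvexSpace ℝ E] [T2Space E]

/-- The point `x + i y` lies on the complex line `t ↦ x + t y`, all of whose points with real
parameter are real. -/
theorem HolomorphicAlongLines.eventuallyEq_of_eq_ofReal {f g : Cx E → Cx E} {W : Set (Cx E)}
    (hW : IsOpen W) (hf : HolomorphicAlongLines f W) (hg : HolomorphicAlongLines g W)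
    (h : ∀ y, Cx.ofReal y ∈ W → f (Cx.ofReal y) = g (Cx.ofReal y)) {x : E}
    (hx : Cx.ofReal x ∈ W) : f =ᶠ[𝓝 (Cx.ofReal x)] g := by
  filter_upwards [Cx.eventually_forall_line_mem hW hx 2] with z hz
  refine Cx.eq_of_forall_dual_eq fun l => ?_
  have hdiff {k : Cx E → Cx E} (hk : HolomorphicAlongLines k W) : DifferentiableOn ℂ
      (fun t => l (k (Cx.ofReal z.re + t • Cx.ofReal z.im))) (Metric.ball (0 : ℂ) 2) := fun t ht =>
    (hk l _ _ t (hz t (Metric.ball_subset_closedBall ht))).differentiableWithinAt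
  have heq := eqOn_ball_of_forall_real_eq two_pos (hdiff hf) (hdiff hg) fun t ht => by
    have hmem := hz t (by simpa using ht.le)
    rw [← Cx.ofReal_add_smul] at hmem ⊢
    exact congrArg l (h _ hmem)
  simpa only [Cx.ofReal_re_add_smul_ofReal_im] using heq (x := Complex.I) (by simp)

end Identity

/-! ### Gluing open subsets of a normal space -/

section Separation

variable {Y Z κ : Type*} [TopologicalSpace Y] [TopologicalSpace Z] [Finite κ]

/-- The closed sets `T ∩ (f l)⁻¹ (D l)` have empty intersection, so their complements form a cover
of `T`. The images of the pieces of a closed shrinking `v` of this cover are removed. -/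
theorem exists_isOpen_superset_of_isClosed_image [NormalSpace Y] {T : Set Y} (hT : IsClosed T)
    {f : κ → Y → Z} (hf : ∀ l, ContinuousOn (f l) T)
    (hfT : ∀ l, ∀ A ⊆ T, IsClosed A → IsClosed (f l '' A))
    {D : κ → Set Z} (hD : ∀ l, IsClosed (D l)) (hTD : ∀ z ∈ T, ∃ l, f l z ∉ D l) :
    ∃ O : κ → Set Z, (∀ l, IsOpen (O l)) ∧ (∀ l, D l ⊆ O l) ∧ ∀ z ∈ T, ∃ l, f l z ∉ O l := by
  have hcl (l : κ) : IsClosed (T ∩ f l ⁻¹' D l) := (hf l).preimage_isClosed_of_isClosed hT (hD l)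
  obtain ⟨v, hTv, hv, hvD⟩ := exists_subset_iUnion_closed_subset hT
    (u := fun l => (T ∩ f l ⁻¹' D l)ᶜ) (fun l => (hcl l).isOpen_compl) (fun x _ => toFinite _)
    (fun z hz => mem_iUnion.2 ((hTD z hz).imp fun l hl h => hl h.2))
  refine ⟨fun l => (f l '' (T ∩ v l))ᶜ,
    fun l => (hfT l _ inter_subset_left (hT.inter (hv l))).isOpen_compl, ?_, fun z hz => ?_⟩
  · rintro l _ hd ⟨z, ⟨hzT, hzv⟩, rfl⟩
    exact hvD l hzv ⟨hzT, hd⟩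
  · obtain ⟨l, hl⟩ := mem_iUnion.1 (hTv hz)
    exact ⟨l, fun h => h ⟨z, ⟨hz, hl⟩, rfl⟩⟩

end Separation

section Gluing

variable {ι Y : Type*} [TopologicalSpace Y]

/-- A family of mutually inverse homeomorphisms `h i j : W i j → W j i` between open subsets of
`Y`, to be used as gluing maps. The cocycle condition is not part of this notion. -/
structure IsTransitionFamily (W : ι → ι → Set Y) (h : ι → ι → Y → Y) : Prop where
  isOpen : ∀ i j, IsOpen (W i j)
  continuousOn : ∀ i j, ContinuousOn (h i j) (W i j)
  mapsTo : ∀ i j, MapsTo (h i j) (W i j) (W j i)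
  leftInvOn : ∀ i j, LeftInvOn (h j i) (h i j) (W i j)

/-- The open sets `V i` can be glued along the maps `h i j`: identifying `z ∈ V i ∩ W i j` with
`h i j z` whenever the latter lies in `V j` is an equivalence relation (`refl` and `trans`), and
no identified points of `V i` and `V j` accumulate at a point of `V i` outside `W i j`, which makes
the quotient regular. -/
structure IsGluable (W : ι → ι → Set Y) (h : ι → ι → Y → Y) (V : ι → Set Y) : Prop where
  isOpen : ∀ i, IsOpen (V i)
  refl : ∀ i, ∀ z ∈ V i, z ∈ W i i ∧ h i i z = z
  trans : ∀ i j k, ∀ z ∈ V i, z ∈ W i j → h i j z ∈ V j → h i j z ∈ W j k →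
    h j k (h i j z) ∈ V k → z ∈ W i k ∧ h i k z = h j k (h i j z)
  closure_subset : ∀ i j, closure (V i ∩ W i j ∩ h i j ⁻¹' V j) ∩ V i ⊆ W i j

variable {W W' : ι → ι → Set Y} {h : ι → ι → Y → Y}

theorem IsGluable.mono {V V' : ι → Set Y} (hV : IsGluable W h V) (hV' : ∀ i, IsOpen (V' i))
    (hsub : ∀ i, V' i ⊆ V i) : IsGluable W h V' where
  isOpen := hV'
  refl i z hz := hV.refl i z (hsub i hz)
  trans i j k z hz hzW hj hjW hk := hV.trans i j k z (hsub i hz) hzW (hsub j hj) hjW (hsub k hk)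
  closure_subset i j := (inter_subset_inter (closure_mono (inter_subset_inter
    (inter_subset_inter_left _ (hsub i)) (preimage_mono (hsub j)))) (hsub i)).trans
      (hV.closure_subset i j)

namespace IsTransitionFamily

theorem isClosed_image (hW : IsTransitionFamily W h) (hW' : IsTransitionFamily W' h)
    (hcl : ∀ i j, closure (W' i j) ⊆ W i j) {i j : ι} {A : Set Y} (hA : IsClosed A)
    (hAW : A ⊆ closure (W' i j)) : IsClosed (h i j '' A) := by
  have hmaps : MapsTo (h i j) (closure (W' i j)) (closure (W' j i)) :=
    (hW'.mapsTo i j).closure_of_continuousOn ((hW.continuousOn i j).mono (hcl i j))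
  have himage : h i j '' A = closure (W' j i) ∩ h j i ⁻¹' A := by
    ext w
    constructor
    · rintro ⟨z, hz, rfl⟩
      refine ⟨hmaps (hAW hz), ?_⟩
      rwa [mem_preimage, hW.leftInvOn i j (hcl i j (hAW hz))]
    · rintro ⟨hw, hwA⟩
      exact ⟨h j i w, hwA, hW.leftInvOn j i (hcl j i hw)⟩
  rw [himage]
  exact ((hW.continuousOn j i).mono (hcl j i)).preimage_isClosed_of_isClosed isClosed_closure hA

theorem exists_shrink [NormalSpace Y] (hW : IsTransitionFamily W h) {A : ι → ι → Set Y}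
    (hA : ∀ i j, IsClosed (A i j)) (hAW : ∀ i j, A i j ⊆ W i j)
    (hAh : ∀ i j, MapsTo (h i j) (A i j) (A j i)) :
    ∃ W' : ι → ι → Set Y, IsTransitionFamily W' h ∧ (∀ i j, A i j ⊆ W' i j) ∧
      ∀ i j, closure (W' i j) ⊆ W i j := by
  choose P hPo hAP hPcl using fun i j =>
    normal_exists_closure_subset (hA i j) (hW.isOpen i j) (hAW i j)
  have hPW (i j : ι) : P i j ⊆ W i j := subset_closure.trans (hPcl i j)
  refine ⟨fun i j => P i j ∩ h i j ⁻¹' P j i, ⟨fun i j => ?_, fun i j => ?_, fun i j z hz => ?_,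
    fun i j z hz => ?_⟩, fun i j z hz => ?_, fun i j => ?_⟩
  · exact ((hW.continuousOn i j).mono (hPW i j)).isOpen_inter_preimage (hPo i j) (hPo j i)
  · exact (hW.continuousOn i j).mono (inter_subset_left.trans (hPW i j))
  · refine ⟨hz.2, ?_⟩
    rw [mem_preimage, hW.leftInvOn i j (hPW i j hz.1)]
    exact hz.1
  · exact hW.leftInvOn i j (hPW i j hz.1)
  · exact ⟨hAP i j hz, hAP j i (hAh i j hz)⟩
  · exact (closure_mono inter_subset_left).trans (hPcl i j)

variable [NormalSpace Y] {D : ι → Set Y}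

/-- The separation lemma is applied to the three maps `id`, `h i j` and `h j k ∘ h i j` on the
closed set of points outside `G` at which both maps `h i j` and `h j k` apply. -/
theorem exists_isOpen_cocycle_mem (hW : IsTransitionFamily W h) (hW' : IsTransitionFamily W' h)
    (hcl : ∀ i j, closure (W' i j) ⊆ W i j) (hD : ∀ i, IsClosed (D i)) {i j k : ι} {G : Set Y}
    (hG : IsOpen G) (hDG : ∀ z ∈ D i, z ∈ W i j → h i j z ∈ D j → h i j z ∈ W j k →
      h j k (h i j z) ∈ D k → z ∈ G) :
    ∃ O₀ O₁ O₂ : Set Y, (IsOpen O₀ ∧ D i ⊆ O₀) ∧ (IsOpen O₁ ∧ D j ⊆ O₁) ∧ (IsOpen O₂ ∧ D k ⊆ O₂) ∧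
      ∀ z ∈ O₀, z ∈ W' i j → h i j z ∈ O₁ → h i j z ∈ W' j k → h j k (h i j z) ∈ O₂ → z ∈ G := by
  let T : Set Y := (closure (W' i j) ∩ h i j ⁻¹' closure (W' j k)) ∩ Gᶜ
  have hTW : T ⊆ W i j := fun z hz => hcl i j hz.1.1
  have hTW' : MapsTo (h i j) T (W j k) := fun z hz => hcl j k hz.1.2
  have hT : IsClosed T := (((hW.continuousOn i j).mono (hcl i j)).preimage_isClosed_of_isClosed
    isClosed_closure isClosed_closure).inter hG.isClosed_compl
  have hij : ContinuousOn (h i j) T := (hW.continuousOn i j).mono hTW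
  have himage (A) (hAT : A ⊆ T) (hA : IsClosed A) : IsClosed (h i j '' A) :=
    hW.isClosed_image hW' hcl hA fun z hz => (hAT hz).1.1
  have himage' (A) (hAT : A ⊆ T) (hA : IsClosed A) : IsClosed (h j k ∘ h i j '' A) := by
    rw [image_comp]
    exact hW.isClosed_image hW' hcl (himage A hAT hA) (image_subset_iff.2 fun z hz => (hAT hz).1.2)
  obtain ⟨O, hO, hDO, hTO⟩ := exists_isOpen_superset_of_isClosed_image hT
    (f := ![id, h i j, h j k ∘ h i j]) (D := ![D i, D j, D k])
    (Fin.forall_fin_succ.2 ⟨continuousOn_id, Fin.forall_fin_two.2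
      ⟨hij, (hW.continuousOn j k).comp hij hTW'⟩⟩)
    (Fin.forall_fin_succ.2 ⟨fun A _ hA => by simpa using hA, Fin.forall_fin_two.2
      ⟨himage, himage'⟩⟩)
    (Fin.forall_fin_succ.2 ⟨hD i, Fin.forall_fin_two.2 ⟨hD j, hD k⟩⟩) fun z hz => by
      by_contra! hcon
      exact hz.2 (hDG z (hcon 0) (hTW hz) (hcon 1) (hTW' hz) (hcon 2))
  refine ⟨O 0, O 1, O 2, ⟨hO 0, hDO 0⟩, ⟨hO 1, hDO 1⟩, ⟨hO 2, hDO 2⟩, fun z h₀ hz h₁ hz' h₂ => ?_⟩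
  by_contra hzG
  obtain ⟨l, hl⟩ := hTO z ⟨⟨subset_closure hz, subset_closure hz'⟩, hzG⟩
  fin_cases l
  exacts [hl h₀, hl h₁, hl h₂]

theorem exists_isOpen_forall_cocycle_mem [Finite ι] (hW : IsTransitionFamily W h)
    (hW' : IsTransitionFamily W' h) (hcl : ∀ i j, closure (W' i j) ⊆ W i j)
    (hD : ∀ i, IsClosed (D i)) {G : ι → ι → ι → Set Y} (hG : ∀ i j k, IsOpen (G i j k))
    (hDG : ∀ i j k, ∀ z ∈ D i, z ∈ W i j → h i j z ∈ D j → h i j z ∈ W j k →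
      h j k (h i j z) ∈ D k → z ∈ G i j k) :
    ∃ O : ι → Set Y, (∀ i, IsOpen (O i)) ∧ (∀ i, D i ⊆ O i) ∧ ∀ i j k, ∀ z ∈ O i, z ∈ W' i j →
      h i j z ∈ O j → h i j z ∈ W' j k → h j k (h i j z) ∈ O k → z ∈ G i j k := by
  choose O₀ O₁ O₂ h₀ h₁ h₂ hO using fun i j k =>
    hW.exists_isOpen_cocycle_mem hW' hcl hD (hG i j k) (hDG i j k)
  refine ⟨fun i => ⋂ j, ⋂ k, O₀ i j k ∩ O₁ j i k ∩ O₂ j k i, fun i =>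
    isOpen_iInter_of_finite fun j => isOpen_iInter_of_finite fun k =>
      ((h₀ i j k).1.inter (h₁ j i k).1).inter (h₂ j k i).1,
    fun i => subset_iInter₂ fun j k =>
      subset_inter (subset_inter (h₀ i j k).2 (h₁ j i k).2) (h₂ j k i).2,
    fun i j k z hi hij hj hjk hk => ?_⟩
  exact hO i j k z (mem_iInter₂.1 hi j k).1.1 hij (mem_iInter₂.1 hj i k).1.2 hjk
    (mem_iInter₂.1 hk i j).2

theorem exists_isGluable [Finite ι] (hW : IsTransitionFamily W h) (hD : ∀ i, IsClosed (D i))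
    (hDD : ∀ i j, IsClosed {z | z ∈ D i ∧ z ∈ W i j ∧ h i j z ∈ D j})
    (hrefl : ∀ i, ∀ z ∈ D i, z ∈ W i i ∧ ∀ᶠ x in 𝓝 z, h i i x = x)
    (htrans : ∀ i j k, ∀ z ∈ D i, z ∈ W i j → h i j z ∈ D j → h i j z ∈ W j k →
      z ∈ W i k ∧ ∀ᶠ x in 𝓝 z, h i k x = h j k (h i j x)) :
    ∃ (W' : ι → ι → Set Y) (V : ι → Set Y), IsTransitionFamily W' h ∧ IsGluable W' h V ∧
      (∀ i j, W' i j ⊆ W i j) ∧ (∀ i, D i ⊆ V i) ∧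
      ∀ i j, ∀ z ∈ D i, z ∈ W i j → h i j z ∈ D j → z ∈ W' i j := by
  obtain ⟨W', hW', hDW', hcl⟩ := hW.exists_shrink hDD (fun i j z hz => hz.2.1) fun i j z hz =>
    ⟨hz.2.2, hW.mapsTo i j hz.2.1, (hW.leftInvOn i j hz.2.1).symm ▸ hz.1⟩
  choose N hNo hDN hNW using fun i j =>
    normal_exists_closure_subset (hDD i j) (hW'.isOpen i j) (hDW' i j)
  let P (i j k : ι) : Set Y := interior {x | h i k x = h j k (h i j x)}
  let Q (i : ι) : Set Y := W' i i ∩ interior {x | h i i x = x}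
  have hDP (i j k z) (hi : z ∈ D i) (hij : z ∈ W i j) (hj : h i j z ∈ D j)
      (hjk : h i j z ∈ W j k) (hk : h j k (h i j z) ∈ D k) : z ∈ N i k ∩ P i j k := by
    obtain ⟨hik, heq⟩ := htrans i j k z hi hij hj hjk
    exact ⟨hDN i k ⟨hi, hik, heq.self_of_nhds.symm ▸ hk⟩, mem_interior_iff_mem_nhds.2 heq⟩
  have hDQ (i : ι) : D i ⊆ Q i := fun z hz => by
    obtain ⟨hii, heq⟩ := hrefl i z hz
    exact ⟨hDW' i i ⟨hz, hii, heq.self_of_nhds.symm ▸ hz⟩, mem_interior_iff_mem_nhds.2 heq⟩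
  obtain ⟨O, hO, hDO, hOP⟩ := hW.exists_isOpen_forall_cocycle_mem hW' hcl hD
    (fun i j k => (hNo i k).inter isOpen_interior) hDP
  have hQ (j z) (hz : z ∈ Q j) : z ∈ W' j j ∧ h j j z = z :=
    ⟨hz.1, (interior_subset hz.2 : z ∈ {x | h j j x = x})⟩
  refine ⟨W', fun i => O i ∩ Q i, hW', ⟨fun i => ?_, fun i z hz => hQ i z hz.2, ?_, fun i j => ?_⟩,
    fun i j => subset_closure.trans (hcl i j), fun i => subset_inter (hDO i) (hDQ i),
    fun i j z hi hij hj => hDW' i j ⟨hi, hij, hj⟩⟩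
  · exact (hO i).inter ((hW'.isOpen i i).inter isOpen_interior)
  · rintro i j k z hi hij hj hjk hk
    obtain ⟨hN, hP⟩ := hOP i j k z hi.1 hij hj.1 hjk hk.1
    exact ⟨hNW i k (subset_closure hN), interior_subset (s := {x | h i k x = h j k (h i j x)}) hP⟩
  · refine inter_subset_left.trans ((closure_mono ?_).trans (hNW i j))
    rintro z ⟨⟨hi, hij⟩, hj⟩
    obtain ⟨hjj, heq⟩ := hQ j _ hj.2
    exact (hOP i j j z hi.1 hij hj.1 hjj (heq.symm ▸ hj.1)).1

end IsTransitionFamily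

end Gluing

/-! ### The glued space -/

section GluedSpace

variable {ι Y : Type*} [TopologicalSpace Y] {W : ι → ι → Set Y} {h : ι → ι → Y → Y}
  {V : ι → Set Y}

/-- If `z ∈ W i j`, a closed neighbourhood of `h i j z` in `W j i` is pulled back; otherwise a
neighbourhood of `z` contains no point identified with a point of `V j`. -/
theorem IsGluable.exists_nhds_isClosed_transport [RegularSpace Y] (hV : IsGluable W h V)
    (hW : IsTransitionFamily W h) {i j : ι} {z : Y} (hz : z ∈ V i) :
    ∃ R ∈ 𝓝 z, ∀ A ⊆ R ∩ V i, IsClosed A → IsClosed {w : V j | (w : Y) ∈ W j i ∧ h j i w ∈ A} := by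
  by_cases hzW : z ∈ W i j
  · obtain ⟨B, hB, hBc, hBW⟩ := exists_mem_nhds_isClosed_subset
      ((hW.isOpen j i).mem_nhds (hW.mapsTo i j hzW))
    refine ⟨h i j ⁻¹' B, ((hW.continuousOn i j).continuousAt
      ((hW.isOpen i j).mem_nhds hzW)).preimage_mem_nhds hB, fun A hA hAc => ?_⟩
    have hpre : {w : V j | (w : Y) ∈ W j i ∧ h j i w ∈ A} = (↑) ⁻¹' (B ∩ h j i ⁻¹' A) := by
      ext w
      refine and_congr_left fun hwA => ⟨fun hw => ?_, fun hwB => hBW hwB⟩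
      rw [← hW.leftInvOn j i hw]
      exact (hA hwA).1
    rw [hpre]
    exact (((hW.continuousOn j i).mono hBW).preimage_isClosed_of_isClosed hBc hAc).preimage
      continuous_subtype_val
  · refine ⟨(closure (V i ∩ W i j ∩ h i j ⁻¹' V j))ᶜ, isClosed_closure.isOpen_compl.mem_nhds
      fun hcl => hzW (hV.closure_subset i j ⟨hcl, hz⟩), fun A hA _ => ?_⟩
    have hempty : {w : V j | (w : Y) ∈ W j i ∧ h j i w ∈ A} = ∅ := by
      refine eq_empty_of_forall_notMem fun w ⟨hw, hwA⟩ => ?_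
      obtain ⟨hwR, hwV⟩ := hA hwA
      refine hwR (subset_closure ⟨⟨hwV, hW.mapsTo j i hw⟩, ?_⟩)
      rw [mem_preimage, hW.leftInvOn j i hw]
      exact w.2
    rw [hempty]
    exact isClosed_empty

/-- The equivalence relation on the disjoint union of the `V i` which identifies `z` with
`h i j z`. -/
def gluingSetoid (hW : IsTransitionFamily W h) (hV : IsGluable W h V) : Setoid (Σ i, V i) where
  r a b := (a.2 : Y) ∈ W a.1 b.1 ∧ h a.1 b.1 a.2 = b.2
  iseqv :=
    { refl := fun a => hV.refl a.1 a.2 a.2.2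
      symm := fun {a b} hab => by
        rw [← hab.2]
        exact ⟨hW.mapsTo _ _ hab.1, hW.leftInvOn _ _ hab.1⟩
      trans := fun {a b c} hab hbc => by
        rw [← hab.2] at hbc
        obtain ⟨hac, heq⟩ := hV.trans a.1 b.1 c.1 a.2 a.2.2 hab.1 (hab.2 ▸ b.2.2) hbc.1
          (hbc.2 ▸ c.2.2)
        exact ⟨hac, heq.trans hbc.2⟩ }

/-- The space obtained by gluing the `V i` along the maps `h i j`. -/
def GluedSpace (hW : IsTransitionFamily W h) (hV : IsGluable W h V) : Type _ :=
  Quotient (gluingSetoid hW hV)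

namespace GluedSpace

variable (hW : IsTransitionFamily W h) (hV : IsGluable W h V)

instance : TopologicalSpace (GluedSpace hW hV) :=
  inferInstanceAs (TopologicalSpace (Quotient (gluingSetoid hW hV)))

/-- The inclusion of `V i` into the glued space. -/
def incl (i : ι) (z : V i) : GluedSpace hW hV := Quotient.mk (gluingSetoid hW hV) ⟨i, z⟩

theorem incl_eq_incl_iff {i j : ι} {z : V i} {w : V j} :
    incl hW hV i z = incl hW hV j w ↔ (z : Y) ∈ W i j ∧ h i j z = w :=
  Quotient.eq (r := gluingSetoid hW hV)

theorem exists_incl_eq (x : GluedSpace hW hV) : ∃ i z, incl hW hV i z = x := by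
  induction x using Quotient.inductionOn with
  | h a => exact ⟨a.1, a.2, rfl⟩

theorem isOpen_iff {s : Set (GluedSpace hW hV)} :
    IsOpen s ↔ ∀ j, IsOpen (incl hW hV j ⁻¹' s) := by
  have hquot : IsQuotientMap (Quotient.mk (gluingSetoid hW hV)) := isQuotientMap_quotient_mk'
  exact hquot.isOpen_preimage.symm.trans isOpen_sigma_iff

theorem isClosed_iff {s : Set (GluedSpace hW hV)} :
    IsClosed s ↔ ∀ j, IsClosed (incl hW hV j ⁻¹' s) := by
  simp only [← isOpen_compl_iff, isOpen_iff, preimage_compl]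

theorem continuous_incl (i : ι) : Continuous (incl hW hV i) :=
  continuous_def.2 fun _ hs => (isOpen_iff hW hV).1 hs i

theorem preimage_image_incl (i j : ι) (A : Set (V i)) :
    incl hW hV j ⁻¹' (incl hW hV i '' A) =
      {w : V j | (w : Y) ∈ W j i ∧ h j i w ∈ Subtype.val '' A} := by
  ext w
  constructor
  · rintro ⟨z, hz, hzw⟩
    obtain ⟨hw, hwz⟩ := (incl_eq_incl_iff hW hV).1 hzw.symm
    exact ⟨hw, z, hz, hwz.symm⟩
  · rintro ⟨hw, z, hz, hzw⟩
    exact ⟨z, hz, ((incl_eq_incl_iff hW hV).2 ⟨hw, hzw.symm⟩).symm⟩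

theorem isOpenEmbedding_incl (i : ι) : IsOpenEmbedding (incl hW hV i) := by
  refine .of_continuous_injective_isOpenMap (continuous_incl hW hV i) (fun z w hzw => ?_)
    fun A hA => (isOpen_iff hW hV).2 fun j => ?_
  · have heq := ((incl_eq_incl_iff hW hV).1 hzw).2
    rw [(hV.refl i z z.2).2] at heq
    exact Subtype.ext heq
  · rw [preimage_image_incl]
    exact ((hW.continuousOn j i).isOpen_inter_preimage (hW.isOpen j i)
      ((hV.isOpen i).isOpenMap_subtype_val A hA)).preimage continuous_subtype_val

instance [T1Space Y] : T1Space (GluedSpace hW hV) := by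
  refine ⟨fun x => ?_⟩
  obtain ⟨i, z, rfl⟩ := exists_incl_eq hW hV x
  rw [isClosed_iff, ← image_singleton]
  intro j
  rw [preimage_image_incl, image_singleton]
  refine Set.Subsingleton.isClosed ?_
  rintro w ⟨hw, hwz⟩ w' ⟨hw', hwz'⟩
  exact Subtype.ext ((hW.leftInvOn j i).injOn hw hw' (hwz.trans hwz'.symm))

instance [RegularSpace Y] [Finite ι] : RegularSpace (GluedSpace hW hV) := by
  refine RegularSpace.of_exists_mem_nhds_isClosed_subset fun x s hs => ?_
  obtain ⟨i, z, rfl⟩ := exists_incl_eq hW hV x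
  choose R hR hRA using fun j => hV.exists_nhds_isClosed_transport hW (i := i) (j := j) z.2
  have hs' : Subtype.val '' (incl hW hV i ⁻¹' s) ∈ 𝓝 (z : Y) :=
    (hV.isOpen i).isOpenMap_subtype_val.image_mem_nhds
      ((continuous_incl hW hV i).continuousAt.preimage_mem_nhds hs)
  obtain ⟨A, hA, hAc, hAs⟩ := exists_mem_nhds_isClosed_subset
    (inter_mem hs' (iInter_mem.2 hR))
  have hAV : A ⊆ V i := fun y hy => Subtype.coe_image_subset _ _ (hAs hy).1
  refine ⟨incl hW hV i '' (Subtype.val ⁻¹' A), ?_, (isClosed_iff hW hV).2 fun j => ?_, ?_⟩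
  · exact (isOpenEmbedding_incl hW hV i).isOpenMap.image_mem_nhds
      (continuous_subtype_val.continuousAt.preimage_mem_nhds hA)
  · rw [preimage_image_incl, Subtype.image_preimage_coe, inter_eq_right.2 hAV]
    exact hRA j A (fun y hy => ⟨mem_iInter.1 (hAs hy).2 j, hAV hy⟩) hAc
  · rintro _ ⟨v, hv, rfl⟩
    obtain ⟨w, hw, hwv⟩ := (hAs hv).1
    rwa [← Subtype.ext hwv]

/-- The chart of the glued space inverse to the inclusion of `V i`. -/
noncomputable def chart (i : ι) [hne : Nonempty (V i)] :
    OpenPartialHomeomorph (GluedSpace hW hV) Y :=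
  (isOpenEmbedding_incl hW hV i).toOpenPartialHomeomorph.symm.trans
    ((⟨V i, hV.isOpen i⟩ : TopologicalSpace.Opens Y).openPartialHomeomorphSubtypeCoe hne)

variable (i : ι) [Nonempty (V i)]

theorem chart_source : (chart hW hV i).source = range (incl hW hV i) := by simp [chart]

theorem chart_target : (chart hW hV i).target = V i := by simp [chart]

theorem chart_incl (z : V i) : chart hW hV i (incl hW hV i z) = z :=
  congrArg Subtype.val
    ((isOpenEmbedding_incl hW hV i).toOpenPartialHomeomorph.left_inv (x := z) (by simp))

theorem chart_symm_apply {z : Y} (hz : z ∈ V i) :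
    (chart hW hV i).symm z = incl hW hV i ⟨z, hz⟩ := by
  have hinv := (chart hW hV i).left_inv (x := incl hW hV i ⟨z, hz⟩)
    (chart_source hW hV i ▸ mem_range_self _)
  rwa [chart_incl] at hinv

end GluedSpace

end GluedSpace

/-! ### Complex extensions of chart changes -/

section Extension

variable {E F : Type*} [AddCommGroup E] [Module ℝ E] [TopologicalSpace E] [AddCommGroup F]
  [Module ℝ F] [TopologicalSpace F] {f f' : E → F} {U V : Set E}

theorem RealAnalyticOn.mono_congr (hf : RealAnalyticOn f U) (hVU : V ⊆ U)
    (h : ∀ x ∈ V, f' x = f x) : RealAnalyticOn f' V := by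
  obtain ⟨W, g, hW, hUW, hg, hgf⟩ := hf
  exact ⟨W, g, hW, (image_mono hVU).trans hUW, hg, fun x hx => by rw [hgf x (hVU hx), h x hx]⟩

/-- `g` is a complex analytic extension of `f` to an open set `W` whose real points are exactly
the points of the domain `U` of `f`. -/
structure IsComplexExtension (f : E → F) (U : Set E) (g : Cx E → Cx F) (W : Set (Cx E)) :
    Prop where
  isOpen : IsOpen W
  analyticOn : ComplexAnalyticOn g W
  ofReal_mem_iff : ∀ x, Cx.ofReal x ∈ W ↔ x ∈ U
  apply_ofReal : ∀ x ∈ U, g (Cx.ofReal x) = Cx.ofReal (f x)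

theorem RealAnalyticOn.exists_isComplexExtension (hf : RealAnalyticOn f U) (hU : IsOpen U) :
    ∃ g W, IsComplexExtension f U g W := by
  obtain ⟨W, g, hW, hUW, hg, hgf⟩ := hf
  have hopen : IsOpen (W ∩ Cx.re ⁻¹' U) := hW.inter (hU.preimage Cx.continuous_re)
  exact ⟨g, W ∩ Cx.re ⁻¹' U, hopen, hg.mono_congr hopen inter_subset_left fun _ _ => rfl,
    fun x => ⟨fun hx => hx.2, fun hx => ⟨hUW (mem_image_of_mem _ hx), hx⟩⟩, hgf⟩

theorem IsComplexExtension.mono {g : Cx E → Cx F} {W W' : Set (Cx E)}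
    (hg : IsComplexExtension f U g W) (hW' : IsOpen W') (hW'W : W' ⊆ W)
    (hUW' : ∀ x ∈ U, Cx.ofReal x ∈ W') : IsComplexExtension f U g W' where
  isOpen := hW'
  analyticOn := hg.analyticOn.mono_congr hW' hW'W fun _ _ => rfl
  ofReal_mem_iff x := ⟨fun hx => (hg.ofReal_mem_iff x).1 (hW'W hx), hUW' x⟩
  apply_ofReal := hg.apply_ofReal

end Extension

section Uniqueness

variable {E : Type*} [AddCommGroup E] [Module ℝ E] [TopologicalSpace E]
  [IsTopologicalAddGroup E] [ContinuousSMul ℝ E] [LocallyConvexSpace ℝ E] [T2Space E]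
  {f f' : E → E} {U U' : Set E} {g g' l : Cx E → Cx E} {W W' R : Set (Cx E)} {x : E}

theorem IsComplexExtension.eventually_eq_comp (hg : IsComplexExtension f U g W)
    (hg' : IsComplexExtension f' U' g' W') (hR : IsOpen R) (hl : HolomorphicAlongLines l R)
    (h : ∀ y ∈ U, f y ∈ U' → Cx.ofReal y ∈ R → l (Cx.ofReal y) = Cx.ofReal (f' (f y)))
    (hx : x ∈ U) (hfx : f x ∈ U') (hxR : Cx.ofReal x ∈ R) :
    ∀ᶠ z in 𝓝 (Cx.ofReal x), l z = g' (g z) := by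
  have hopen : IsOpen (R ∩ (W ∩ g ⁻¹' W')) :=
    hR.inter (hg.analyticOn.1.isOpen_inter_preimage hg.isOpen hg'.isOpen)
  have hmem (y : E) : Cx.ofReal y ∈ W ∩ g ⁻¹' W' ↔ y ∈ U ∧ f y ∈ U' := by
    rw [mem_inter_iff, hg.ofReal_mem_iff]
    refine and_congr_right fun hy => ?_
    rw [mem_preimage, hg.apply_ofReal y hy, hg'.ofReal_mem_iff]
  refine HolomorphicAlongLines.eventuallyEq_of_eq_ofReal hopen (hl.mono inter_subset_left)
    ((hg.analyticOn.holomorphicAlongLines_comp hg.isOpen hg'.isOpen hg'.analyticOn).mono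
      inter_subset_right) (fun y hy => ?_) ⟨hxR, (hmem x).2 ⟨hx, hfx⟩⟩
  obtain ⟨hyU, hfy⟩ := (hmem y).1 hy.2
  rw [h y hyU hfy hy.1, hg.apply_ofReal y hyU, hg'.apply_ofReal _ hfy]

theorem IsComplexExtension.eventually_leftInverse (hg : IsComplexExtension f U g W)
    (hg' : IsComplexExtension f' U' g' W') (hmaps : MapsTo f U U') (hinv : LeftInvOn f' f U)
    (hx : x ∈ U) : ∀ᶠ z in 𝓝 (Cx.ofReal x), g' (g z) = z :=
  (hg.eventually_eq_comp hg' isOpen_univ (holomorphicAlongLines_id univ)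
    (fun _ hy _ _ => congrArg Cx.ofReal (hinv hy).symm) hx (hmaps hx) (mem_univ _)).mono
    fun _ => Eq.symm

end Uniqueness

section TransitionFamily

variable {E : Type*} [AddCommGroup E] [Module ℝ E] [TopologicalSpace E]
  {M : Type*} [TopologicalSpace M] {ι : Type*}

namespace IsComplexExtension

variable {d d' : OpenPartialHomeomorph M E} {g : Cx E → Cx E} {S : Set (Cx E)} {x : M}

theorem ofReal_chart_mem_iff
    (hg : IsComplexExtension (d.symm ≫ₕ d') (d.symm ≫ₕ d').source g S) (hx : x ∈ d.source) :
    Cx.ofReal (d x) ∈ S ↔ x ∈ d'.source := by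
  rw [hg.ofReal_mem_iff, OpenPartialHomeomorph.trans_source, OpenPartialHomeomorph.symm_source,
    mem_inter_iff, mem_preimage, d.left_inv hx, and_iff_right (d.map_source hx)]

theorem apply_ofReal_chart
    (hg : IsComplexExtension (d.symm ≫ₕ d') (d.symm ≫ₕ d').source g S) (hx : x ∈ d.source)
    (hx' : x ∈ d'.source) : g (Cx.ofReal (d x)) = Cx.ofReal (d' x) := by
  have hsource := (hg.ofReal_mem_iff _).1 ((hg.ofReal_chart_mem_iff hx).2 hx')
  rw [hg.apply_ofReal _ hsource, OpenPartialHomeomorph.trans_apply, d.left_inv hx]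

theorem of_chart (hS : IsOpen S) (hg : ComplexAnalyticOn g S)
    (htarget : ∀ u, Cx.ofReal u ∈ S → u ∈ d.target)
    (hmem : ∀ y ∈ d.source, Cx.ofReal (d y) ∈ S ↔ y ∈ d'.source)
    (happly : ∀ y ∈ d.source, y ∈ d'.source → g (Cx.ofReal (d y)) = Cx.ofReal (d' y)) :
    IsComplexExtension (d.symm ≫ₕ d') (d.symm ≫ₕ d').source g S where
  isOpen := hS
  analyticOn := hg
  ofReal_mem_iff u := by
    refine ⟨fun hu => ⟨htarget u hu, ?_⟩, fun hu => ?_⟩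
    · exact (hmem _ (d.map_target (htarget u hu))).1 (by rwa [d.right_inv (htarget u hu)])
    · rw [← d.right_inv hu.1]
      exact (hmem _ (d.map_target hu.1)).2 hu.2
  apply_ofReal u hu := by
    have hdu := happly _ (d.map_target hu.1) hu.2
    rwa [d.right_inv hu.1] at hdu

end IsComplexExtension

/-- The gluing maps `h i j` are complex analytic extensions of the changes between the charts
`c i`. -/
structure IsComplexTransitionFamily (c : ι → OpenPartialHomeomorph M E)
    (W : ι → ι → Set (Cx E)) (h : ι → ι → Cx E → Cx E) : Prop
    extends IsTransitionFamily W h where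
  isComplexExtension : ∀ i j,
    IsComplexExtension ((c i).symm ≫ₕ c j) ((c i).symm ≫ₕ c j).source (h i j) (W i j)

variable {c : ι → OpenPartialHomeomorph M E} {W : ι → ι → Set (Cx E)}
  {h : ι → ι → Cx E → Cx E}

namespace IsComplexTransitionFamily

theorem ofReal_mem_iff (hW : IsComplexTransitionFamily c W h) {i : ι} (j : ι) {x : M}
    (hx : x ∈ (c i).source) : Cx.ofReal (c i x) ∈ W i j ↔ x ∈ (c j).source :=
  (hW.isComplexExtension i j).ofReal_chart_mem_iff hx

theorem apply_ofReal (hW : IsComplexTransitionFamily c W h) {i j : ι} {x : M}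
    (hi : x ∈ (c i).source) (hj : x ∈ (c j).source) :
    h i j (Cx.ofReal (c i x)) = Cx.ofReal (c j x) :=
  (hW.isComplexExtension i j).apply_ofReal_chart hi hj

end IsComplexTransitionFamily

variable [IsTopologicalAddGroup E] [ContinuousSMul ℝ E] [LocallyConvexSpace ℝ E] [T2Space E]

theorem exists_isComplexTransitionFamily
    (hc : ∀ i j, RealAnalyticOn ((c i).symm ≫ₕ c j) ((c i).symm ≫ₕ c j).source) :
    ∃ W h, IsComplexTransitionFamily c W h := by
  choose g S hg using fun i j =>
    (hc i j).exists_isComplexExtension ((c i).symm ≫ₕ c j).open_source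
  let H (i j : ι) : Set (Cx E) := S i j ∩ interior {z | g j i (g i j z) = z}
  have hmaps (i j : ι) :
      MapsTo ((c i).symm ≫ₕ c j) ((c i).symm ≫ₕ c j).source ((c j).symm ≫ₕ c i).source :=
    ((c i).symm ≫ₕ c j).mapsTo
  have hinv (i j : ι) :
      LeftInvOn ((c j).symm ≫ₕ c i) ((c i).symm ≫ₕ c j) ((c i).symm ≫ₕ c j).source :=
    ((c i).symm ≫ₕ c j).leftInvOn
  have hgH (i j : ι) :
      IsComplexExtension ((c i).symm ≫ₕ c j) ((c i).symm ≫ₕ c j).source (g i j) (H i j) :=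
    (hg i j).mono ((hg i j).isOpen.inter isOpen_interior) inter_subset_left fun x hx =>
      ⟨((hg i j).ofReal_mem_iff x).2 hx, mem_interior_iff_mem_nhds.2
        ((hg i j).eventually_leftInverse (hg j i) (hmaps i j) (hinv i j) hx)⟩
  have hHinv (i j z) (hz : z ∈ H i j) : g j i (g i j z) = z :=
    interior_subset (s := {z | g j i (g i j z) = z}) hz.2
  have hopen (i j : ι) : IsOpen (H i j ∩ g i j ⁻¹' H j i) :=
    (hgH i j).analyticOn.1.isOpen_inter_preimage (hgH i j).isOpen (hgH j i).isOpen
  refine ⟨fun i j => H i j ∩ g i j ⁻¹' H j i, g, ⟨hopen, fun i j => ?_, fun i j z hz => ?_,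
    fun i j z hz => hHinv i j z hz.1⟩, fun i j => (hgH i j).mono (hopen i j) inter_subset_left
    fun x hx => ⟨((hgH i j).ofReal_mem_iff x).2 hx, ?_⟩⟩
  · exact (hgH i j).analyticOn.1.mono inter_subset_left
  · refine ⟨hz.2, ?_⟩
    rw [mem_preimage, hHinv i j z hz.1]
    exact hz.1
  · rw [mem_preimage, (hgH i j).apply_ofReal x hx, (hgH j i).ofReal_mem_iff]
    exact hmaps i j hx

namespace IsComplexTransitionFamily

variable {i j k : ι} {x : M}

theorem eventually_refl (hW : IsComplexTransitionFamily c W h) (hx : x ∈ (c i).source) :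
    ∀ᶠ z in 𝓝 (Cx.ofReal (c i x)), h i i z = z := by
  refine ((hW.isComplexExtension i i).analyticOn.holomorphicAlongLines).eventuallyEq_of_eq_ofReal
    (hW.isOpen i i) (holomorphicAlongLines_id _) (fun y hy => ?_) ((hW.ofReal_mem_iff i hx).2 hx)
  have hy' := ((hW.isComplexExtension i i).ofReal_mem_iff y).1 hy
  rw [(hW.isComplexExtension i i).apply_ofReal y hy', OpenPartialHomeomorph.trans_apply,
    (c i).right_inv hy'.1]

theorem eventually_trans (hW : IsComplexTransitionFamily c W h) (hi : x ∈ (c i).source)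
    (hj : x ∈ (c j).source) (hk : x ∈ (c k).source) :
    ∀ᶠ z in 𝓝 (Cx.ofReal (c i x)), h i k z = h j k (h i j z) := by
  have hmem {a b : ι} (ha : x ∈ (c a).source) (hb : x ∈ (c b).source) :=
    ((hW.isComplexExtension a b).ofReal_mem_iff _).1 ((hW.ofReal_mem_iff b ha).2 hb)
  refine (hW.isComplexExtension i j).eventually_eq_comp (hW.isComplexExtension j k) (hW.isOpen i k)
    (hW.isComplexExtension i k).analyticOn.holomorphicAlongLines (fun y hy _ hyR => ?_)
    (hmem hi hj) ?_ ((hW.ofReal_mem_iff k hi).2 hk)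
  · rw [(hW.isComplexExtension i k).apply_ofReal y
      (((hW.isComplexExtension i k).ofReal_mem_iff y).1 hyR)]
    have hinv : (c j).symm (c j ((c i).symm y)) = (c i).symm y := (c j).left_inv hy.2
    simp only [OpenPartialHomeomorph.trans_apply, hinv]
  · rw [OpenPartialHomeomorph.trans_apply, (c i).left_inv hi]
    exact hmem hj hk

end IsComplexTransitionFamily

end TransitionFamily

/-! ### Adapted atlases -/

section AdaptedAtlas

theorem comap_inf_principal_congr {α β : Type*} {f g : α → β} {s : Set α} {l : Filter β}
    (h : EqOn f g s) : comap f l ⊓ 𝓟 s = comap g l ⊓ 𝓟 s := by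
  have hle {f g : α → β} (h : EqOn f g s) : comap f l ⊓ 𝓟 s ≤ comap g l :=
    tendsto_iff_comap.1 <| (tendsto_comap.mono_left inf_le_left).congr' <|
      eventually_inf_principal.2 (Eventually.of_forall h)
  exact le_antisymm (le_inf (hle h) inf_le_right) (le_inf (hle h.symm) inf_le_right)

variable {E : Type*} [AddCommGroup E] [TopologicalSpace E] {N : Type*} [TopologicalSpace N]
  {X : Type*} [TopologicalSpace X] {ι : Type*}

/-- The `ψ i` are charts of `X` with values in `E_ℂ`, covering `X`, which restrict along `φ` to
charts `d i` of `N` with values in `E`. No analyticity is required. -/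
structure IsAdaptedAtlas (φ : N → X) (ψ : ι → OpenPartialHomeomorph X (Cx E))
    (d : ι → OpenPartialHomeomorph N E) : Prop where
  iUnion_source : ⋃ i, (ψ i).source = univ
  source_eq : ∀ i, (d i).source = φ ⁻¹' (ψ i).source
  eq_on : ∀ i, ∀ y ∈ (d i).source, ψ i (φ y) = Cx.ofReal (d i y)
  mem_target : ∀ i u, Cx.ofReal u ∈ (ψ i).target → u ∈ (d i).target

variable {φ : N → X} {ψ : ι → OpenPartialHomeomorph X (Cx E)} {d : ι → OpenPartialHomeomorph N E}

namespace IsAdaptedAtlas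

theorem mem_source_iff (h : IsAdaptedAtlas φ ψ d) {i : ι} {y : N} :
    y ∈ (d i).source ↔ φ y ∈ (ψ i).source := by
  rw [h.source_eq, mem_preimage]

theorem exists_mem_source (h : IsAdaptedAtlas φ ψ d) (y : N) : ∃ i, y ∈ (d i).source := by
  simpa only [h.mem_source_iff] using iUnion_eq_univ_iff.1 h.iUnion_source (φ y)

theorem symm_ofReal (h : IsAdaptedAtlas φ ψ d) {i : ι} {y : N} (hy : y ∈ (d i).source) :
    (ψ i).symm (Cx.ofReal (d i y)) = φ y := by
  rw [← h.eq_on i y hy, (ψ i).left_inv (h.mem_source_iff.1 hy)]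

theorem isEmbedding (h : IsAdaptedAtlas φ ψ d) : IsEmbedding φ := by
  refine ⟨isInducing_iff_nhds.2 fun y => ?_, fun y y' hyy' => ?_⟩
  · obtain ⟨i, hi⟩ := h.exists_mem_source y
    have hreal : IsInducing (Cx.ofReal : E → Cx E) :=
      .of_comp Cx.continuous_ofReal Cx.continuous_re .id
    calc
      𝓝 y = comap (d i) (comap Cx.ofReal (𝓝 (Cx.ofReal (d i y)))) ⊓ 𝓟 (d i).source := by
        rw [← hreal.nhds_eq_comap, ← (d i).nhds_eq_comap_inf_principal hi]
      _ = comap (ψ i ∘ φ) (𝓝 (ψ i (φ y))) ⊓ 𝓟 (φ ⁻¹' (ψ i).source) := by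
        rw [comap_comap, ← h.eq_on i y hi, ← h.source_eq]
        exact comap_inf_principal_congr fun z hz => (h.eq_on i z hz).symm
      _ = comap φ (comap (ψ i) (𝓝 (ψ i (φ y))) ⊓ 𝓟 (ψ i).source) := by
        rw [comap_inf, comap_comap, comap_principal]
      _ = comap φ (𝓝 (φ y)) := by
        rw [← (ψ i).nhds_eq_comap_inf_principal (h.mem_source_iff.1 hi)]
  · obtain ⟨i, hi⟩ := h.exists_mem_source y
    have hi' : y' ∈ (d i).source := h.mem_source_iff.2 (hyy' ▸ h.mem_source_iff.1 hi)
    refine (d i).injOn hi hi' (Cx.ofReal_injective ?_)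
    rw [← h.eq_on i y hi, ← h.eq_on i y' hi', hyy']

theorem image_eq (h : IsAdaptedAtlas φ ψ d) (i : ι) :
    ψ i '' (range φ ∩ (ψ i).source) = range Cx.ofReal ∩ (ψ i).target := by
  ext z
  constructor
  · rintro ⟨_, ⟨⟨y, rfl⟩, hy⟩, rfl⟩
    exact ⟨⟨_, (h.eq_on i y (h.mem_source_iff.2 hy)).symm⟩, (ψ i).map_source hy⟩
  · rintro ⟨⟨u, rfl⟩, hu⟩
    have hy := (d i).map_target (h.mem_target i u hu)
    refine ⟨φ ((d i).symm u), ⟨mem_range_self _, h.mem_source_iff.1 hy⟩, ?_⟩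
    rw [h.eq_on i _ hy, (d i).right_inv (h.mem_target i u hu)]

theorem change_ofReal (h : IsAdaptedAtlas φ ψ d) {i j : ι} {u : E}
    (hu : u ∈ ((d i).symm ≫ₕ d j).source) :
    Cx.ofReal u ∈ ((ψ i).symm ≫ₕ ψ j).source ∧
      ((ψ i).symm ≫ₕ ψ j) (Cx.ofReal u) = Cx.ofReal (((d i).symm ≫ₕ d j) u) := by
  obtain ⟨hut, huj⟩ : u ∈ (d i).target ∧ (d i).symm u ∈ (d j).source := hu
  have hy : (d i).symm u ∈ (d i).source := (d i).map_target hut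
  have hψ : (ψ i).symm (Cx.ofReal u) = φ ((d i).symm u) := by
    rw [← h.symm_ofReal hy, (d i).right_inv hut]
  refine ⟨⟨?_, ?_⟩, ?_⟩
  · have hmap := (ψ i).map_source (h.mem_source_iff.1 hy)
    rwa [h.eq_on i _ hy, (d i).right_inv hut] at hmap
  · change (ψ i).symm (Cx.ofReal u) ∈ (ψ j).source
    rw [hψ]
    exact h.mem_source_iff.1 huj
  · rw [OpenPartialHomeomorph.trans_apply, hψ, h.eq_on j _ huj, OpenPartialHomeomorph.trans_apply]

/-- The charted space whose atlas consists of the `ψ i`. -/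
@[reducible] noncomputable def chartedSpace (h : IsAdaptedAtlas φ ψ d) :
    ChartedSpace (Cx E) X where
  atlas := range ψ
  chartAt x := ψ (iUnion_eq_univ_iff.1 h.iUnion_source x).choose
  mem_chart_source x := (iUnion_eq_univ_iff.1 h.iUnion_source x).choose_spec
  chart_mem_atlas _ := mem_range_self _

end IsAdaptedAtlas

end AdaptedAtlas

section Complexification

variable {E : Type*} [AddCommGroup E] [Module ℝ E] [TopologicalSpace E] {N : Type*}
  [TopologicalSpace N] [ChartedSpace E N] {X : Type*} [TopologicalSpace X] {φ : N → X}

theorem IsAdaptedAtlas.restrictsToChart {ι : Type*} {ψ : ι → OpenPartialHomeomorph X (Cx E)}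
    {d : ι → OpenPartialHomeomorph N E} (h : IsAdaptedAtlas φ ψ d)
    (hψ : ∀ i j, ComplexAnalyticOn ((ψ i).symm ≫ₕ ψ j) ((ψ i).symm ≫ₕ ψ j).source)
    (hd : ∀ i, IsRealAnalyticChart (d i)) (i : ι) :
    letI := h.chartedSpace
    RestrictsToChart φ (ψ i) (d i) :=
  letI := h.chartedSpace
  { complexChart := by
      rintro _ ⟨j, rfl⟩
      exact ⟨hψ i j, hψ j i⟩
    realChart := hd i
    image_eq := h.image_eq i
    source_eq := h.source_eq i
    eq_on := h.eq_on i }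

theorem IsAdaptedAtlas.isComplexification [T2Space X] {ι : Type*}
    {ψ : ι → OpenPartialHomeomorph X (Cx E)} {d : ι → OpenPartialHomeomorph N E}
    (h : IsAdaptedAtlas φ ψ d)
    (hψ : ∀ i j, ComplexAnalyticOn ((ψ i).symm ≫ₕ ψ j) ((ψ i).symm ≫ₕ ψ j).source)
    (hd : ∀ i, IsRealAnalyticChart (d i)) :
    letI := h.chartedSpace
    IsComplexification (E := E) φ :=
  letI := h.chartedSpace
  { manifold := ⟨inferInstance, by
      rintro _ ⟨i, rfl⟩ _ ⟨j, rfl⟩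
      exact hψ i j⟩
    isEmbedding := h.isEmbedding
    exists_chart := fun y =>
      let ⟨i, hi⟩ := h.exists_mem_source y
      ⟨ψ i, d i, h.mem_source_iff.1 hi, h.restrictsToChart hψ hd i⟩ }

theorem IsAdaptedAtlas.isFinitelyGlued {n : ℕ} {ψ : Fin n → OpenPartialHomeomorph X (Cx E)}
    {d : Fin n → OpenPartialHomeomorph N E} (h : IsAdaptedAtlas φ ψ d)
    (hψ : ∀ i j, ComplexAnalyticOn ((ψ i).symm ≫ₕ ψ j) ((ψ i).symm ≫ₕ ψ j).source)
    (hd : ∀ i, IsRealAnalyticChart (d i)) :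
    letI := h.chartedSpace
    IsFinitelyGlued (E := E) φ :=
  letI := h.chartedSpace
  ⟨n, ψ, d, rfl, h.restrictsToChart hψ hd, h.iUnion_source,
    iUnion_eq_univ_iff.2 h.exists_mem_source, fun i j => ⟨hψ i j, fun _ hu => h.change_ofReal hu⟩⟩

end Complexification

/-! ### Complexifications by gluing -/

section ComplexGluing

variable {E : Type*} [AddCommGroup E] [Module ℝ E] [TopologicalSpace E] {N : Type*}
  [TopologicalSpace N] {ι : Type*}

/-- The open sets `V i` of `E_ℂ` can be glued along the maps `h i j` to a complexification of `N`:
the real points of `V i` are the target of the chart `d i`, and the gluing maps extend the changes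
between these charts. -/
structure IsComplexGluing (d : ι → OpenPartialHomeomorph N E) (W : ι → ι → Set (Cx E))
    (h : ι → ι → Cx E → Cx E) (V : ι → Set (Cx E)) : Prop where
  isTransitionFamily : IsTransitionFamily W h
  isGluable : IsGluable W h V
  ofReal_mem_iff : ∀ i u, Cx.ofReal u ∈ V i ↔ u ∈ (d i).target
  isComplexExtension : ∀ i j, IsComplexExtension ((d i).symm ≫ₕ d j)
    ((d i).symm ≫ₕ d j).source (h i j) (V i ∩ W i j ∩ h i j ⁻¹' V j)

namespace IsComplexGluing

variable {d : ι → OpenPartialHomeomorph N E} {W : ι → ι → Set (Cx E)}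
    {h : ι → ι → Cx E → Cx E} {V : ι → Set (Cx E)}

theorem ofReal_mem (hG : IsComplexGluing d W h V) {i : ι} {y : N} (hy : y ∈ (d i).source) :
    Cx.ofReal (d i y) ∈ V i :=
  (hG.ofReal_mem_iff i _).2 ((d i).map_source hy)

open GluedSpace

variable [∀ i, Nonempty (V i)]

theorem exists_isAdaptedAtlas (hG : IsComplexGluing d W h V) (hd : ⋃ i, (d i).source = univ) :
    ∃ φ : N → GluedSpace hG.isTransitionFamily hG.isGluable,
      IsAdaptedAtlas φ (fun i => chart hG.isTransitionFamily hG.isGluable i) d := by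
  let incl' {i : ι} {y : N} (hy : y ∈ (d i).source) :=
    incl hG.isTransitionFamily hG.isGluable i ⟨Cx.ofReal (d i y), hG.ofReal_mem hy⟩
  choose k hk using iUnion_eq_univ_iff.1 hd
  have hφ {i : ι} {y : N} (hy : y ∈ (d i).source) : incl' (hk y) = incl' hy :=
    (incl_eq_incl_iff _ _).2
      ⟨(((hG.isComplexExtension (k y) i).ofReal_chart_mem_iff (hk y)).2 hy).1.2,
        (hG.isComplexExtension (k y) i).apply_ofReal_chart (hk y) hy⟩
  refine ⟨fun y => incl' (hk y), iUnion_eq_univ_iff.2 fun x => ?_, fun i => ?_, fun i y hy => ?_,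
    fun i u hu => ?_⟩
  · obtain ⟨i, z, rfl⟩ := exists_incl_eq _ _ x
    exact ⟨i, chart_source hG.isTransitionFamily hG.isGluable i ▸ mem_range_self z⟩
  · ext y
    rw [mem_preimage, chart_source]
    refine ⟨fun hy => ⟨_, (hφ hy).symm⟩, fun ⟨w, hw⟩ => ?_⟩
    obtain ⟨hyW, hyw⟩ := (incl_eq_incl_iff _ _).1 hw.symm
    exact ((hG.isComplexExtension (k y) i).ofReal_chart_mem_iff (hk y)).1
      ⟨⟨hG.ofReal_mem (hk y), hyW⟩, mem_preimage.2 (hyw ▸ w.2)⟩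
  · simp only [hφ hy]
    exact chart_incl _ _ i _
  · rwa [chart_target, hG.ofReal_mem_iff] at hu

theorem complexAnalyticOn_chart_change (hG : IsComplexGluing d W h V) (i j : ι) :
    ComplexAnalyticOn
      ((chart hG.isTransitionFamily hG.isGluable i).symm ≫ₕ
        chart hG.isTransitionFamily hG.isGluable j)
      ((chart hG.isTransitionFamily hG.isGluable i).symm ≫ₕ
        chart hG.isTransitionFamily hG.isGluable j).source := by
  have hchange : ∀ z ∈ ((chart hG.isTransitionFamily hG.isGluable i).symm ≫ₕ
      chart hG.isTransitionFamily hG.isGluable j).source,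
      z ∈ V i ∩ W i j ∩ h i j ⁻¹' V j ∧ chart hG.isTransitionFamily hG.isGluable j
        ((chart hG.isTransitionFamily hG.isGluable i).symm z) = h i j z := by
    rintro z ⟨hz, hzj⟩
    have hzi : z ∈ V i := chart_target hG.isTransitionFamily hG.isGluable i ▸ hz
    change (chart hG.isTransitionFamily hG.isGluable i).symm z ∈
      (chart hG.isTransitionFamily hG.isGluable j).source at hzj
    rw [chart_symm_apply _ _ i hzi, chart_source] at hzj
    rw [chart_symm_apply _ _ i hzi]
    obtain ⟨w, hw⟩ := hzj
    obtain ⟨hzW, hzw⟩ := (incl_eq_incl_iff _ _).1 hw.symm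
    rw [← hw, chart_incl]
    exact ⟨⟨⟨hzi, hzW⟩, mem_preimage.2 (hzw ▸ w.2)⟩, hzw.symm⟩
  exact (hG.isComplexExtension i j).analyticOn.mono_congr (OpenPartialHomeomorph.open_source _)
    (fun z hz => (hchange z hz).1) fun z hz => (hchange z hz).2

end IsComplexGluing

end ComplexGluing

/-! ### Charts of open subsets -/

section Restriction

variable {E : Type*} [AddCommGroup E] [Module ℝ E] [TopologicalSpace E] {M : Type*}
  [TopologicalSpace M]

theorem RealAnalyticOn.chart_change_of_comp {N : Type*} [TopologicalSpace N] {f : N → M}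
    {e e' : OpenPartialHomeomorph M E} {d d' : OpenPartialHomeomorph N E}
    (he : RealAnalyticOn (e.symm ≫ₕ e') (e.symm ≫ₕ e').source)
    (hd : ∀ y ∈ d.source, f y ∈ e.source ∧ d y = e (f y))
    (hd' : ∀ y ∈ d'.source, f y ∈ e'.source ∧ d' y = e' (f y)) :
    RealAnalyticOn (d.symm ≫ₕ d') (d.symm ≫ₕ d').source := by
  have hsymm : ∀ u ∈ (d.symm ≫ₕ d').source, u ∈ e.target ∧ e.symm u = f (d.symm u) := by
    rintro u ⟨hu, -⟩
    obtain ⟨hsource, heq⟩ := hd _ (d.map_target hu)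
    rw [d.right_inv hu] at heq
    exact ⟨heq ▸ e.map_source hsource, by rw [← e.left_inv hsource, ← heq]⟩
  refine he.mono_congr (fun u hu => ⟨(hsymm u hu).1, ?_⟩) fun u hu => ?_
  · change e.symm u ∈ e'.source
    rw [(hsymm u hu).2]
    exact (hd' _ hu.2).1
  · rw [OpenPartialHomeomorph.trans_apply, OpenPartialHomeomorph.trans_apply, (hsymm u hu).2]
    exact (hd' _ hu.2).2

theorem IsRealAnalyticManifold.isRealAnalyticChart_subtypeRestr [ChartedSpace E M]
    (hM : IsRealAnalyticManifold E M) {e : OpenPartialHomeomorph M E} (he : e ∈ atlas E M)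
    (s : Set M) {Ω : TopologicalSpace.Opens M} (hΩ : Nonempty Ω) :
    IsRealAnalyticChart ((e.restr s).subtypeRestr hΩ) := by
  intro d' hd'
  obtain ⟨x, rfl⟩ : ∃ x : Ω, (chartAt E (x : M)).subtypeRestr ⟨x⟩ = d' := by
    simpa [atlas, ChartedSpace.atlas] using hd'
  have hd : ∀ y ∈ ((e.restr s).subtypeRestr hΩ).source,
      (y : M) ∈ e.source ∧ (e.restr s).subtypeRestr hΩ y = e y := fun y hy => by
    rw [OpenPartialHomeomorph.subtypeRestr_source] at hy
    exact ⟨hy.1, rfl⟩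
  have hd' : ∀ y ∈ ((chartAt E (x : M)).subtypeRestr (s := Ω) ⟨x⟩).source,
      (y : M) ∈ (chartAt E (x : M)).source ∧
        (chartAt E (x : M)).subtypeRestr (s := Ω) ⟨x⟩ y = chartAt E (x : M) y := fun y hy => by
    rw [OpenPartialHomeomorph.subtypeRestr_source] at hy
    exact ⟨hy, rfl⟩
  exact ⟨(hM.compatible _ he _ (chart_mem_atlas E _)).chart_change_of_comp hd hd',
    (hM.compatible _ (chart_mem_atlas E _) _ he).chart_change_of_comp hd' hd⟩

end Restriction

/-! ### Closed pieces of charts -/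

section ClosedPiece

/-- `B` is a closed subset of the domain of the chart `e` whose closed subsets have closed images
in the *whole* model space, not just in the target of `e`. -/
structure IsClosedChartPiece {M Y : Type*} [TopologicalSpace M] [TopologicalSpace Y]
    (e : OpenPartialHomeomorph M Y) (B : Set M) : Prop where
  isClosed : IsClosed B
  subset_source : B ⊆ e.source
  isClosed_image : ∀ A ⊆ B, IsClosed A → IsClosed (e '' A)

theorem exists_mem_nhds_isClosedChartPiece {M Y : Type*} [TopologicalSpace M] [TopologicalSpace Y]
    [RegularSpace M] [RegularSpace Y] (e : OpenPartialHomeomorph M Y) {x : M}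
    (hx : x ∈ e.source) : ∃ B ∈ 𝓝 x, IsClosedChartPiece e B := by
  obtain ⟨C, hC, hCc, hCt⟩ := exists_mem_nhds_isClosed_subset
    (e.open_target.mem_nhds (e.map_source hx))
  obtain ⟨B, hB, hBc, hBs⟩ := exists_mem_nhds_isClosed_subset
    (inter_mem (e.open_source.mem_nhds hx) ((e.continuousAt hx).preimage_mem_nhds hC))
  refine ⟨B, hB, hBc, fun y hy => (hBs hy).1, fun A hA hAc => ?_⟩
  have himage : e '' A = C ∩ e.symm ⁻¹' A := by
    ext u
    constructor
    · rintro ⟨y, hy, rfl⟩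
      refine ⟨(hBs (hA hy)).2, ?_⟩
      rwa [mem_preimage, e.left_inv (hBs (hA hy)).1]
    · rintro ⟨hu, huA⟩
      exact ⟨e.symm u, huA, e.right_inv (hCt hu)⟩
  rw [himage]
  exact (e.continuousOn_symm.mono hCt).preimage_isClosed_of_isClosed hCc hAc

theorem exists_finite_isClosedChartPiece_cover (Y : Type*) {M : Type*} [TopologicalSpace M]
    [TopologicalSpace Y] [RegularSpace M] [RegularSpace Y] [ChartedSpace Y M] {K : Set M}
    (hK : IsCompact K) : ∃ (n : ℕ) (p : Fin n → M) (B : Fin n → Set M),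
      (∀ i, p i ∈ interior (B i)) ∧ K ⊆ ⋃ i, interior (B i) ∧
      ∀ i, IsClosedChartPiece (chartAt Y (p i)) (B i) := by
  choose b hb hpiece using fun x : M =>
    exists_mem_nhds_isClosedChartPiece (chartAt Y x) (mem_chart_source Y x)
  obtain ⟨t, -, hKt⟩ := hK.elim_nhds_subcover (fun x => interior (b x))
    fun x _ => interior_mem_nhds.2 (hb x)
  refine ⟨t.card, fun i => t.equivFin.symm i, fun i => b (t.equivFin.symm i),
    fun i => mem_interior_iff_mem_nhds.2 (hb _), fun x hx => ?_, fun i => hpiece _⟩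
  obtain ⟨y, hy, hxy⟩ := mem_iUnion₂.1 (hKt hx)
  exact mem_iUnion.2 ⟨t.equivFin ⟨y, hy⟩, by simpa only [Equiv.symm_apply_apply] using hxy⟩

end ClosedPiece

section ClosedPieceGluing

variable {E : Type*} [AddCommGroup E] [Module ℝ E] [TopologicalSpace E]
  [IsTopologicalAddGroup E] [ContinuousSMul ℝ E] [LocallyConvexSpace ℝ E] [T2Space E]
  {M : Type*} [TopologicalSpace M] {ι : Type*} {c : ι → OpenPartialHomeomorph M E}
  {B : ι → Set M} {W : ι → ι → Set (Cx E)} {h : ι → ι → Cx E → Cx E}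

theorem IsComplexTransitionFamily.exists_isGluable_of_isClosedChartPiece [NormalSpace (Cx E)]
    [Finite ι] (hW : IsComplexTransitionFamily c W h)
    (hB : ∀ i, IsClosedChartPiece (c i) (B i)) :
    ∃ W' V, IsTransitionFamily W' h ∧ IsGluable W' h V ∧ (∀ i j, W' i j ⊆ W i j) ∧
      (∀ i, ∀ x ∈ B i, Cx.ofReal (c i x) ∈ V i) ∧
      ∀ i j, ∀ x ∈ B i ∩ B j, Cx.ofReal (c i x) ∈ W' i j := by
  let γ (i : ι) (x : M) : Cx E := Cx.ofReal (c i x)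
  have hsource {i x} (hx : x ∈ B i) : x ∈ (c i).source := (hB i).subset_source hx
  have hγ {i x} (hx : x ∈ (c i).source) (hxB : γ i x ∈ γ i '' B i) : x ∈ B i := by
    obtain ⟨y, hy, hyx⟩ := hxB
    rwa [← (c i).injOn (hsource hy) hx (Cx.ofReal_injective hyx)]
  have hclosed (i : ι) {A : Set M} (hAB : A ⊆ B i) (hA : IsClosed A) : IsClosed (γ i '' A) := by
    rw [← image_image Cx.ofReal (c i)]
    exact Cx.isClosedEmbedding_ofReal.isClosedMap _ ((hB i).isClosed_image A hAB hA)
  have hoverlap (i j : ι) :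
      {z | z ∈ γ i '' B i ∧ z ∈ W i j ∧ h i j z ∈ γ j '' B j} = γ i '' (B i ∩ B j) := by
    ext z
    constructor
    · rintro ⟨⟨x, hx, rfl⟩, hxW, hxB⟩
      have hxj := (hW.ofReal_mem_iff j (hsource hx)).1 hxW
      rw [hW.apply_ofReal (hsource hx) hxj] at hxB
      exact ⟨x, ⟨hx, hγ hxj hxB⟩, rfl⟩
    · rintro ⟨x, ⟨hxi, hxj⟩, rfl⟩
      refine ⟨mem_image_of_mem _ hxi, (hW.ofReal_mem_iff j (hsource hxi)).2 (hsource hxj), ?_⟩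
      exact ⟨x, hxj, (hW.apply_ofReal (hsource hxi) (hsource hxj)).symm⟩
  obtain ⟨W', V, hW', hV, hW'W, hDV, hDW'⟩ := hW.toIsTransitionFamily.exists_isGluable
    (D := fun i => γ i '' B i) (fun i => hclosed i subset_rfl (hB i).isClosed)
    (fun i j => hoverlap i j ▸ hclosed i inter_subset_left ((hB i).isClosed.inter (hB j).isClosed))
    (by
      rintro i _ ⟨x, hx, rfl⟩
      exact ⟨(hW.ofReal_mem_iff i (hsource hx)).2 (hsource hx), hW.eventually_refl (hsource hx)⟩)
    (by
      rintro i j k _ ⟨x, hx, rfl⟩ hxj - hxk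
      replace hxj := (hW.ofReal_mem_iff j (hsource hx)).1 hxj
      rw [hW.apply_ofReal (hsource hx) hxj] at hxk
      replace hxk := (hW.ofReal_mem_iff k hxj).1 hxk
      exact ⟨(hW.ofReal_mem_iff k (hsource hx)).2 hxk,
        hW.eventually_trans (hsource hx) hxj hxk⟩)
  refine ⟨W', V, hW', hV, hW'W, fun i x hx => hDV i (mem_image_of_mem _ hx), fun i j x hx => ?_⟩
  obtain ⟨hxD, hxW, hxD'⟩ := (hoverlap i j).ge (mem_image_of_mem _ hx)
  exact hDW' i j _ hxD hxW hxD'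

theorem IsComplexTransitionFamily.exists_isComplexGluing [NormalSpace (Cx E)] [Finite ι]
    (hW : IsComplexTransitionFamily c W h) (hB : ∀ i, IsClosedChartPiece (c i) (B i))
    {N : Type*} [TopologicalSpace N] {f : N → M} (hf : Function.Injective f)
    {d : ι → OpenPartialHomeomorph N E}
    (hd : ∀ i, ∀ y ∈ (d i).source, f y ∈ B i ∧ d i y = c i (f y)) :
    ∃ W' V, IsComplexGluing d W' h V := by
  obtain ⟨W', V, hW', hV, hW'W, hBV, hBW'⟩ := hW.exists_isGluable_of_isClosedChartPiece hB
  have hopen (i : ι) : IsOpen (V i ∩ Cx.re ⁻¹' (d i).target) :=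
    (hV.isOpen i).inter ((d i).open_target.preimage Cx.continuous_re)
  have hmem (i : ι) (u : E) : Cx.ofReal u ∈ V i ∩ Cx.re ⁻¹' (d i).target ↔ u ∈ (d i).target := by
    refine ⟨fun hu => hu.2, fun hu => ⟨?_, hu⟩⟩
    obtain ⟨hyB, hyc⟩ := hd i _ ((d i).map_target hu)
    rw [← (d i).right_inv hu, hyc]
    exact hBV i _ hyB
  have hsource {i y} (hy : y ∈ (d i).source) : f y ∈ (c i).source :=
    (hB i).subset_source (hd i y hy).1
  have happly {i j y} (hy : y ∈ (d i).source) (hy' : f y ∈ (c j).source) :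
      h i j (Cx.ofReal (d i y)) = Cx.ofReal (c j (f y)) := by
    rw [(hd i y hy).2, hW.apply_ofReal (hsource hy) hy']
  refine ⟨W', fun i => V i ∩ Cx.re ⁻¹' (d i).target, hW', hV.mono hopen fun _ => inter_subset_left,
    hmem, fun i j => ?_⟩
  have hopen' : IsOpen (V i ∩ Cx.re ⁻¹' (d i).target ∩ W' i j ∩
      h i j ⁻¹' (V j ∩ Cx.re ⁻¹' (d j).target)) := by
    rw [inter_assoc]
    exact (hopen i).inter
      ((hW'.continuousOn i j).isOpen_inter_preimage (hW'.isOpen i j) (hopen j))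
  refine .of_chart hopen' ((hW.isComplexExtension i j).analyticOn.mono_congr hopen'
    (fun z hz => hW'W i j hz.1.2) fun _ _ => rfl) (fun u hu => hu.1.1.2) (fun y hy => ⟨?_, ?_⟩) ?_
  · rintro ⟨⟨-, hyW⟩, hyj⟩
    have hyc : f y ∈ (c j).source :=
      (hW.ofReal_mem_iff j (hsource hy)).1 ((hd i y hy).2 ▸ hW'W i j hyW)
    rw [mem_preimage, happly hy hyc, hmem] at hyj
    obtain ⟨hxB, hxc⟩ := hd j _ ((d j).map_target hyj)
    rw [(d j).right_inv hyj] at hxc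
    rw [hf ((c j).injOn hyc ((hB j).subset_source hxB) hxc)]
    exact (d j).map_target hyj
  · intro hyj
    refine ⟨⟨(hmem i _).2 ((d i).map_source hy), ?_⟩, ?_⟩
    · rw [(hd i y hy).2]
      exact hBW' i j _ ⟨(hd i y hy).1, (hd j y hyj).1⟩
    · rw [mem_preimage, happly hy (hsource hyj), ← (hd j y hyj).2, hmem]
      exact (d j).map_source hyj
  · intro y hy hyj
    rw [happly hy (hsource hyj), (hd j y hyj).2]

end ClosedPieceGluing

theorem theoremA {E : Type v} [AddCommGroup E] [Module ℝ E] [TopologicalSpace E]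
    [IsTopologicalAddGroup E] [ContinuousSMul ℝ E] [LocallyConvexSpace ℝ E] [T2Space E]
    {M : Type u} [TopologicalSpace M] [ChartedSpace E M]
    (hM : IsRealAnalyticManifold E M)
    (hreg : RegularSpace M) (hnormal : NormalSpace (Cx E))
    (K : Set M) (hK : IsCompact K) :
    ∃ Ω : TopologicalSpace.Opens M, K ⊆ (Ω : Set M) ∧
      ∃ (X : Type v) (_ : TopologicalSpace X) (_ : ChartedSpace (Cx E) X) (φ : Ω → X),
        IsComplexification (E := E) φ ∧ T3Space X ∧ IsFinitelyGlued (E := E) φ := by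
  obtain ⟨n, p, B, hp, hKB, hB⟩ := exists_finite_isClosedChartPiece_cover E hK
  let Ω : TopologicalSpace.Opens M := ⟨⋃ i, interior (B i), isOpen_iUnion fun _ => isOpen_interior⟩
  let q (i : Fin n) : Ω := ⟨p i, mem_iUnion.2 ⟨i, hp i⟩⟩
  let d (i : Fin n) : OpenPartialHomeomorph Ω E :=
    ((chartAt E (p i)).restr (B i)).subtypeRestr ⟨q i⟩
  have hsource (i : Fin n) (y : Ω) : y ∈ (d i).source ↔ (y : M) ∈ interior (B i) := by
    rw [OpenPartialHomeomorph.subtypeRestr_source]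
    exact and_iff_right_of_imp fun hy => (hB i).subset_source (interior_subset hy)
  obtain ⟨W, h, hW⟩ := exists_isComplexTransitionFamily fun i j =>
    hM.compatible _ (chart_mem_atlas E (p i)) _ (chart_mem_atlas E (p j))
  obtain ⟨W', V, hG⟩ := hW.exists_isComplexGluing hB Subtype.val_injective (d := d)
    fun i y hy => ⟨interior_subset ((hsource i y).1 hy), rfl⟩
  have (i : Fin n) : Nonempty (V i) := ⟨_, hG.ofReal_mem ((hsource i (q i)).2 (hp i))⟩
  obtain ⟨φ, hφ⟩ := hG.exists_isAdaptedAtlas <| iUnion_eq_univ_iff.2 fun y =>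
    (mem_iUnion.1 y.2).imp fun i hi => (hsource i y).2 hi
  have hd (i : Fin n) : IsRealAnalyticChart (d i) :=
    hM.isRealAnalyticChart_subtypeRestr (chart_mem_atlas E (p i)) (B i) ⟨q i⟩
  exact ⟨Ω, hKB, _, inferInstance, hφ.chartedSpace, φ,
    hφ.isComplexification hG.complexAnalyticOn_chart_change hd, inferInstance,
    hφ.isFinitelyGlued hG.complexAnalyticOn_chart_change hd⟩
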